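/- Fix $N$ persons and two strongly connected directed networks on $\{1,\dots,N\}$ with edge sets $E_R$ (rumor) and $E_T$ (truth); $(i,j)\in E_R$ (resp. $E_T$) means that person $j$ can tell the rumor (resp. the truth) to person $i$. Consider the generic URTU model $$\begin{aligned} \frac{dR_i}{dt}&=(1-R_i-T_i)\,f_i^U(\mathbf R)-\delta_i^R R_i+T_i\,f_i^T(\mathbf R)-R_i\,g_i^R(\mathbf T),\\ \frac{dT_i}{dt}&=(1-R_i-T_i)\,g_i^U(\mathbf T)-\delta_i^T T_i+R_i\,g_i^R(\mathbf T)-T_i\,f_i^T(\mathbf R),\qquad 1\le i\le N, \end{aligned}$$ where $\mathbf R=(R_1,\dots,R_N)$ and $\mathbf T=(T_1,\dots,T_N)$ are the vectors of the probabilities of believing the rumor and the truth, $\delta_i^R,\delta_i^T>0$, and the rates $f_i^U,f_i^T,g_i^U,g_i^R:[0,1]^N\to\mathbb R$ satisfy: $f_i^U$ and $f_i^T$ depend on the argument $x_j$ if and only if $(i,j)\in E_R$, and $g_i^U$ and $g_i^R$ if and only if $(i,j)\in E_T$; all of them vanish at $\mathbf 0$; $f_i^U\ge f_i^T$ and $g_i^U\ge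 g_i^R$; all of them are twice continuously differentiable; the partial derivative of a rate with respect to each argument on which it depends is everywhere positive; and all second-order partial derivatives of the rates are $\le 0$. Let $$\Omega=\{(\mathbf R,\mathbf T)\in\mathbb R_+^{2N}: R_i+T_i\le 1,\ 1\le i\le N\},$$ $$\mathbf Q_1=\frac{\partial\mathbf f_U(\mathbf 0)}{\partial\mathbf x}-\mathrm{diag}(\delta_i^R),\qquad \mathbf Q_2=\frac{\partial\mathbf g_U(\mathbf 0)}{\partial\mathbf x}-\mathrm{diag}(\delta_i^T),$$ where $\mathbf f_U=(f_1^U,\dots,f_N^U)$ and $\mathbf g_U=(g_1^U,\dots,g_N^U)$, and let $s(\mathbf A)$ denote the maximum real part of an eigenvalue of $\mathbf A$. Theorem. Suppose $s(\mathbf Q_1)\le 0$ and $s(\mathbf Q_2)>0$. Then the model has a unique truth-dominant equilibrium $\mathbf E_T=(\mathbf 0,\mathbf T^*)$ in $\Omega$ (an equilibrium whose rumor part is $\mathbf 0$ and whose truth part $\mathbf T^*$ is not $\mathbf 0$), and $\mathbf E_T$ attracts $\{(\mathbf R,\mathbf T)\in\Omega:\mathbf T\ne\mathbf 0\}$: from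 each state of this set there starts a solution that exists for all $t\ge 0$, and every such solution tends to $\mathbf E_T$ as $t\to\infty$. Hence, for a solution starting in $\Omega$, with $R(t)=\frac1N\sum_i R_i(t)$, $T(t)=\frac1N\sum_i T_i(t)$ and $T^*=\frac1N\sum_i T_i^*$: if $T(0)\ne 0$, then $R(t)\to 0$ and $T(t)\to T^*$ as $t\to\infty$. -/

import Mathlib

open Filter Topology

noncomputable section

namespace URTU

/-- The unit cube `[0,1]^N`: the vectors of probabilities on which the spreading rates are
defined. All regularity and sign conditions are imposed on the cube only. -/
def cube (N : ℕ) : Set (Fin N → ℝ) := Set.Icc 0 1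

/-- The `j`-th partial derivative of a function on the cube (one-sided on the boundary). -/
def partialDeriv {N : ℕ} (j : Fin N) (f : (Fin N → ℝ) → ℝ) (x : Fin N → ℝ) : ℝ :=
  fderivWithin ℝ f (cube N) x (Pi.single j 1)

/-- On the cube, `f` depends on its `j`-th argument: changing that argument alone can change the
value of `f`. -/
def DependsOnArg {N : ℕ} (f : (Fin N → ℝ) → ℝ) (j : Fin N) : Prop :=
  ∃ x ∈ cube N, ∃ y ∈ cube N, (∀ k, k ≠ j → x k = y k) ∧ f x ≠ f y

/-- The conditions that a family of spreading rates `f_1, …, f_N` over a network with edge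
relation `E` has to meet on its own. `E i j` means that person `j` can influence person `i`. -/
structure IsSpreadingRate {N : ℕ} (E : Fin N → Fin N → Prop)
    (f : Fin N → (Fin N → ℝ) → ℝ) : Prop where
  proximity : ∀ i j, DependsOnArg (f i) j ↔ E i j
  nullity : ∀ i, f i 0 = 0
  smooth : ∀ i, ContDiffOn ℝ 2 (f i) (cube N)
  monotone : ∀ i j, DependsOnArg (f i) j → ∀ x ∈ cube N, 0 < partialDeriv j (f i) x
  concave : ∀ i j k, ∀ x ∈ cube N, partialDeriv j (partialDeriv k (f i)) x ≤ 0

/-- A directed network is strongly connected if any two nodes are joined by a directed path. -/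
def StronglyConnected {N : ℕ} (E : Fin N → Fin N → Prop) : Prop :=
  ∀ i j, Relation.ReflTransGen E i j

/-- The parameters of the generic Uncertain-Rumor-Truth-Uncertain model with `N` persons. -/
structure Model (N : ℕ) where
  /-- the rumor-spreading network: `ER i j` if person `j` can tell the rumor to person `i` -/
  ER : Fin N → Fin N → Prop
  /-- the truth-spreading network: `ET i j` if person `j` can tell the truth to person `i` -/
  ET : Fin N → Fin N → Prop
  /-- rates at which uncertain persons turn to believe the rumor -/
  fU : Fin N → (Fin N → ℝ) → ℝ
  /-- rates at which truth-believers turn to believe the rumor -/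
  fT : Fin N → (Fin N → ℝ) → ℝ
  /-- rates at which uncertain persons turn to believe the truth -/
  gU : Fin N → (Fin N → ℝ) → ℝ
  /-- rates at which rumor-believers turn to believe the truth -/
  gR : Fin N → (Fin N → ℝ) → ℝ
  /-- rates at which rumor-believers turn uncertain -/
  δR : Fin N → ℝ
  /-- rates at which truth-believers turn uncertain -/
  δT : Fin N → ℝ
  stronglyConnected_ER : StronglyConnected ER
  stronglyConnected_ET : StronglyConnected ET
  fU_rate : IsSpreadingRate ER fU
  fT_rate : IsSpreadingRate ER fT
  gU_rate : IsSpreadingRate ET gU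
  gR_rate : IsSpreadingRate ET gR
  fT_le_fU : ∀ i, ∀ x ∈ cube N, fT i x ≤ fU i x
  gR_le_gU : ∀ i, ∀ x ∈ cube N, gR i x ≤ gU i x
  δR_pos : ∀ i, 0 < δR i
  δT_pos : ∀ i, 0 < δT i

/-- A state `(R, T)`: `R i`, `T i` are the probabilities that person `i` believes the rumor,
respectively the truth. -/
abbrev State (N : ℕ) : Type := (Fin N → ℝ) × (Fin N → ℝ)

/-- The set `Ω` of admissible states. -/
def Ω (N : ℕ) : Set (State N) :=
  {x | (∀ i, 0 ≤ x.1 i) ∧ (∀ i, 0 ≤ x.2 i) ∧ ∀ i, x.1 i + x.2 i ≤ 1}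

/-- The average of a vector; the average of `R(t)` is the fraction of rumor-believers, the
average of `T(t)` the fraction of truth-believers. -/
def average {N : ℕ} (v : Fin N → ℝ) : ℝ := (1 / (N : ℝ)) * ∑ i, v i

/-- The maximum real part of a (complex) eigenvalue of a real square matrix. -/
def maxRealPart {N : ℕ} (A : Matrix (Fin N) (Fin N) ℝ) : ℝ :=
  sSup (Complex.re ''
    {μ : ℂ | Module.End.HasEigenvalue (Matrix.toLin' (A.map (fun r : ℝ => (r : ℂ)))) μ})

/-- The Jacobian matrix at the origin of the map with components `f_1, …, f_N`. -/
def jacobianAtZero {N : ℕ} (f : Fin N → (Fin N → ℝ) → ℝ) : Matrix (Fin N) (Fin N) ℝ :=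
  Matrix.of fun i j => partialDeriv j (f i) 0

namespace Model

variable {N : ℕ} (M : Model N)

/-- The right-hand side of the generic URTU model. -/
def field (x : State N) : State N :=
  (fun i => (1 - x.1 i - x.2 i) * M.fU i x.1 - M.δR i * x.1 i
      + x.2 i * M.fT i x.1 - x.1 i * M.gR i x.2,
   fun i => (1 - x.1 i - x.2 i) * M.gU i x.2 - M.δT i * x.2 i
      + x.1 i * M.gR i x.2 - x.2 i * M.fT i x.1)

/-- `Q₁`, the Jacobian of `f_U` at the origin minus `diag (δR)`. -/
def Q₁ : Matrix (Fin N) (Fin N) ℝ := jacobianAtZero M.fU - Matrix.diagonal M.δR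

/-- `Q₂`, the Jacobian of `g_U` at the origin minus `diag (δT)`. -/
def Q₂ : Matrix (Fin N) (Fin N) ℝ := jacobianAtZero M.gU - Matrix.diagonal M.δT

/-- `x` solves the model on `[0, ∞)`. The arguments of the spreading rates have to lie in the
cube, where the rates are defined. -/
def IsSolution (x : ℝ → State N) : Prop :=
  ∀ t, 0 ≤ t → (x t).1 ∈ cube N ∧ (x t).2 ∈ cube N ∧
    HasDerivWithinAt x (M.field (x t)) (Set.Ici 0) t

/-- `E` is an equilibrium of the model. -/
def IsEquilibrium (E : State N) : Prop := E ∈ Ω N ∧ M.field E = 0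

/-- `E` is a truth-dominant equilibrium of the model. -/
def IsTruthDominant (E : State N) : Prop := M.IsEquilibrium E ∧ E.1 = 0 ∧ E.2 ≠ 0

/-- `E` attracts `S`: from every state in `S` there starts a solution that exists for all times,
and every such solution tends to `E`. -/
def Attracts (E : State N) (S : Set (State N)) : Prop :=
  ∀ x₀ ∈ S, (∃ x, M.IsSolution x ∧ x 0 = x₀) ∧
    ∀ x, M.IsSolution x → x 0 = x₀ → Tendsto x atTop (𝓝 E)

end Model

end URTU

end

/-! The proof is by comparison. Let `u` be the vector of upper limits of the components of a
solution of `y' ≤ (1 - y) f(y) - δ y`. Since `f` is monotone, `u` is a subsolution of the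
equilibrium equations: `δ u ≤ (1 - u) f(u)` (`limsup_subsolution`). Dually, lower limits form a
supersolution, even if the differential inequality holds only up to a vanishing error
(`liminf_supersolution`).

The rumor part satisfies such an upper inequality, because `fT ≤ fU` and `gR ≥ 0`. Concavity gives
`f(u) ≤ J u` with `J` the Jacobian at the origin, so `Q₁ u ≥ u f(u) ≥ ε u` componentwise for some `ε
> 0`. A nonzero `u ≥ 0` with this property would force a positive maximal real part
(`maxRealPart_pos`, by Gelfand's formula for a nonnegative shift of the matrix). Hence `u = 0` and
the rumor dies out.

The truth part then obeys the single-rate system of `gU` up to a vanishing error. Its upper limits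
`u` form a subsolution and its lower limits `l` a supersolution. As `s(Q₂) > 0`, small multiples of
a vector expanded by `Q₂` are strict subsolutions and eventually bound the truth from below
(`exists_eventually_le_snd`), so `l ≠ 0`, and strong connectedness makes `l` positive. Sublinearity
of `gU` places every subsolution below every positive supersolution
(`subsolution_le_supersolution`); hence `u = l` and the solution converges. The same comparison
shows that the limit does not depend on the solution, and uniqueness of the equilibrium follows,
since an equilibrium is a constant solution. -/

noncomputable section

namespace URTU

open Set

/-! ### Scalar differential inequalities -/

section Scalar

/-- A function that cannot decrease while it is negative stays nonnegative. -/
lemma nonneg_of_deriv_nonneg_of_neg {y y' : ℝ → ℝ} {a : ℝ}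
    (hy : ∀ t, a ≤ t → HasDerivWithinAt y (y' t) (Ici a) t) (h0 : 0 ≤ y a)
    (h : ∀ t, a ≤ t → y t < 0 → 0 ≤ y' t) : ∀ t, a ≤ t → 0 ≤ y t := by
  intro t ht
  -- The fencing lemma wants a strict inequality of slopes at contact, hence a barrier of slope `ε >
  -- 0`. The summand `1` keeps the barrier positive, so `y < 0` at contact and the hypothesis
  -- applies.
  have key : ∀ ε > 0, -y t ≤ ε * (1 + (t - a)) := by
    intro ε hε
    refine image_le_of_deriv_right_lt_deriv_boundary (f := fun s => -y s) (f' := fun s => -y' s)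
      (B := fun s => ε * (1 + (s - a))) (B' := fun _ => ε) (a := a) (b := t) ?_ ?_ ?_ ?_ ?_
      (right_mem_Icc.2 ht)
    · intro s hs
      exact ((hy s hs.1).continuousWithinAt.mono Icc_subset_Ici_self).neg
    · intro s hs
      exact ((hy s hs.1).mono (Ici_subset_Ici.2 hs.1)).neg
    · simp; linarith
    · intro s
      simpa using (((hasDerivAt_id s).sub_const a).const_add 1).const_mul ε
    · intro s hs hEq
      have h1 : 0 < ε * (1 + (s - a)) := mul_pos hε (by linarith [hs.1])
      have := h s hs.1 (by linarith)
      linarith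
  have hpos : 0 < 1 + (t - a) := by linarith
  by_contra hneg
  push Not at hneg
  have := key (-y t / (2 * (1 + (t - a)))) (div_pos (by linarith) (by linarith))
  have e : -y t / (2 * (1 + (t - a))) * (1 + (t - a)) = -y t / 2 := by field_simp
  rw [e] at this
  linarith

lemma hasDerivAt_exp_decay (b c a t : ℝ) :
    HasDerivAt (fun s => c * Real.exp (-b * (s - a))) (-b * (c * Real.exp (-b * (t - a)))) t := by
  have h : HasDerivAt (fun s => -b * (s - a)) (-b) t := by
    simpa using ((hasDerivAt_id t).sub_const a).const_mul (-b)
  exact (h.exp.const_mul c).congr_deriv (by ring)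

/-- Comparison with the exact solution of `z' = a - b z` having the same initial value, which tends
to `a / b`. -/
lemma eventually_le_of_deriv_le {y y' : ℝ → ℝ} {t₀ a b : ℝ} (hb : 0 < b)
    (hy : ∀ t, t₀ ≤ t → HasDerivWithinAt y (y' t) (Ici t₀) t)
    (h : ∀ t, t₀ ≤ t → y' t ≤ a - b * y t) {ε : ℝ} (hε : 0 < ε) :
    ∀ᶠ t in atTop, y t ≤ a / b + ε := by
  have key : ∀ t, t₀ ≤ t →
      0 ≤ (y t₀ - a / b) * Real.exp (-b * (t - t₀)) + a / b - y t := by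
    refine nonneg_of_deriv_nonneg_of_neg
      (y' := fun t => -b * ((y t₀ - a / b) * Real.exp (-b * (t - t₀))) - y' t) ?_ (by simp) ?_
    · intro t ht
      exact ((hasDerivAt_exp_decay b _ t₀ t).hasDerivWithinAt.add_const _).sub (hy t ht)
    · intro t ht hneg
      have h1 := h t ht
      have h2 : b * ((y t₀ - a / b) * Real.exp (-b * (t - t₀)) + a / b - y t) ≤ 0 :=
        mul_nonpos_of_nonneg_of_nonpos hb.le hneg.le
      have h3 : b * (a / b) = a := by field_simp
      nlinarith
  have hlim : Tendsto (fun t => (y t₀ - a / b) * Real.exp (-b * (t - t₀))) atTop (𝓝 0) := by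
    have : Tendsto (fun t => -b * (t - t₀)) atTop atBot :=
      (tendsto_atTop_add_const_right _ (-t₀) tendsto_id).const_mul_atTop_of_neg (by linarith)
    simpa using (Real.tendsto_exp_atBot.comp this).const_mul (y t₀ - a / b)
  filter_upwards [hlim.eventually (eventually_lt_nhds hε), eventually_ge_atTop t₀] with t h1 h2
  linarith [key t h2]

lemma eventually_ge_of_le_deriv {y y' : ℝ → ℝ} {t₀ a b : ℝ} (hb : 0 < b)
    (hy : ∀ t, t₀ ≤ t → HasDerivWithinAt y (y' t) (Ici t₀) t)
    (h : ∀ t, t₀ ≤ t → a - b * y t ≤ y' t) {ε : ℝ} (hε : 0 < ε) :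
    ∀ᶠ t in atTop, a / b - ε ≤ y t := by
  have := eventually_le_of_deriv_le (y := fun t => -y t) (y' := fun t => -y' t) (a := -a) hb
    (fun t ht => (hy t ht).neg) (fun t ht => by linarith [h t ht]) hε
  filter_upwards [this] with t ht
  rw [neg_div] at ht
  linarith

/-- The exponential `y a * exp (-c (t - a))` is a positive lower barrier. -/
lemma pos_of_le_deriv {y y' : ℝ → ℝ} {a c : ℝ} (hc : 0 ≤ c)
    (hy : ∀ t, a ≤ t → HasDerivWithinAt y (y' t) (Ici a) t)
    (h : ∀ t, a ≤ t → -c * y t ≤ y' t) (h0 : 0 < y a) : ∀ t, a ≤ t → 0 < y t := by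
  intro t ht
  have key := nonneg_of_deriv_nonneg_of_neg (y := fun t => y t - y a * Real.exp (-c * (t - a)))
    (y' := fun t => y' t - -c * (y a * Real.exp (-c * (t - a))))
    (fun t ht => (hy t ht).sub (hasDerivAt_exp_decay c _ a t).hasDerivWithinAt) (by simp)
    (fun t ht hneg => by
      have h1 := h t ht
      have h2 : c * (y t - y a * Real.exp (-c * (t - a))) ≤ 0 :=
        mul_nonpos_of_nonneg_of_nonpos hc hneg.le
      nlinarith) t ht
  have : 0 < y a * Real.exp (-c * (t - a)) := by positivity
  linarith

end Scalar

/-! ### Calculus on the unit cube -/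

section Cube

variable {N : ℕ}

lemma mem_cube {x : Fin N → ℝ} : x ∈ cube N ↔ ∀ i, 0 ≤ x i ∧ x i ≤ 1 :=
  ⟨fun h i => ⟨h.1 i, h.2 i⟩, fun h => ⟨fun i => (h i).1, fun i => (h i).2⟩⟩

lemma cube_eq_pi : cube N = Set.univ.pi fun _ => Icc (0 : ℝ) 1 := by
  ext x
  simp only [mem_cube, mem_univ_pi, mem_Icc]

lemma zero_mem_cube : (0 : Fin N → ℝ) ∈ cube N := mem_cube.2 fun _ => by simp

lemma convex_cube : Convex ℝ (cube N) := convex_Icc _ _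

lemma isCompact_cube : IsCompact (cube N) := isCompact_Icc

lemma uniqueDiffOn_cube : UniqueDiffOn ℝ (cube N) := by
  rw [cube_eq_pi]
  exact UniqueDiffOn.univ_pi fun _ => uniqueDiffOn_Icc zero_lt_one

lemma smul_mem_cube {x : Fin N → ℝ} (hx : x ∈ cube N) {t : ℝ} (ht : t ∈ Icc (0 : ℝ) 1) :
    t • x ∈ cube N :=
  mem_cube.2 fun i => ⟨mul_nonneg ht.1 (mem_cube.1 hx i).1,
    mul_le_one₀ ht.2 (mem_cube.1 hx i).1 (mem_cube.1 hx i).2⟩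

lemma apply_eq_sum_single (L : (Fin N → ℝ) →L[ℝ] ℝ) (v : Fin N → ℝ) :
    L v = ∑ j, v j * L (Pi.single j 1) := by
  conv_lhs => rw [pi_eq_sum_univ' v]
  rw [map_sum]
  refine Finset.sum_congr rfl fun j _ => ?_
  rw [map_smul, smul_eq_mul]

lemma hasDerivWithinAt_line {f : (Fin N → ℝ) → ℝ} (hf : DifferentiableOn ℝ f (cube N))
    {x v : Fin N → ℝ} {s : Set ℝ} (hs : ∀ t ∈ s, x + t • v ∈ cube N) {t : ℝ} (ht : t ∈ s) :
    HasDerivWithinAt (fun r : ℝ => f (x + r • v))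
      (∑ j, v j * partialDeriv j f (x + t • v)) s t := by
  have h1 : HasDerivWithinAt (fun r : ℝ => x + r • v) v s t := by
    simpa using (((hasDerivAt_id t).smul_const v).const_add x).hasDerivWithinAt
  have h2 := (hf _ (hs t ht)).hasFDerivWithinAt.comp_hasDerivWithinAt t h1 hs
  refine h2.congr_deriv ?_
  rw [apply_eq_sum_single]
  rfl

lemma add_smul_sub_mem_cube {x y : Fin N → ℝ} (hx : x ∈ cube N) (hy : y ∈ cube N) {t : ℝ}
    (ht : t ∈ Icc (0 : ℝ) 1) : x + t • (y - x) ∈ cube N :=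
  convex_cube.add_smul_sub_mem hx hy ht

lemma monotoneOn_of_partialDeriv_nonneg {f : (Fin N → ℝ) → ℝ}
    (hf : DifferentiableOn ℝ f (cube N))
    (h : ∀ j, ∀ x ∈ cube N, 0 ≤ partialDeriv j f x) : MonotoneOn f (cube N) := by
  intro x hx y hy hxy
  have hd : ∀ t ∈ Icc (0 : ℝ) 1, HasDerivWithinAt (fun r : ℝ => f (x + r • (y - x)))
      (∑ j, (y - x) j * partialDeriv j f (x + t • (y - x))) (Icc 0 1) t := fun t ht =>
    hasDerivWithinAt_line hf (fun t ht => add_smul_sub_mem_cube hx hy ht) ht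
  have := monotoneOn_of_hasDerivWithinAt_nonneg (convex_Icc (0 : ℝ) 1)
    (fun t ht => (hd t ht).continuousWithinAt)
    (fun t ht => (hd t (interior_subset ht)).mono interior_subset)
    (fun t ht => Finset.sum_nonneg fun j _ => mul_nonneg (sub_nonneg.2 (hxy j))
      (h j _ (add_smul_sub_mem_cube hx hy (interior_subset ht))))
    (left_mem_Icc.2 zero_le_one) (right_mem_Icc.2 zero_le_one) zero_le_one
  simpa using this

lemma hasDerivWithinAt_update {f : (Fin N → ℝ) → ℝ} (hf : DifferentiableOn ℝ f (cube N))
    {x : Fin N → ℝ} (hx : x ∈ cube N) (j : Fin N) {t : ℝ} (ht : t ∈ Icc (0 : ℝ) 1) :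
    HasDerivWithinAt (fun r : ℝ => f (Function.update x j r))
      (partialDeriv j f (Function.update x j t)) (Icc 0 1) t := by
  have hm : ∀ r ∈ Icc (0 : ℝ) 1, Function.update x j r ∈ cube N := by
    intro r hr
    refine mem_cube.2 fun i => ?_
    rcases eq_or_ne i j with rfl | hij
    · simpa using hr
    · simpa [hij] using mem_cube.1 hx i
  exact (hf _ (hm t ht)).hasFDerivWithinAt.comp_hasDerivWithinAt t
    (hasDerivAt_update x j t).hasDerivWithinAt hm

lemma differentiableOn_partialDeriv {f : (Fin N → ℝ) → ℝ} (hf : ContDiffOn ℝ 2 f (cube N))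
    (j : Fin N) : DifferentiableOn ℝ (partialDeriv j f) (cube N) := by
  have h : ContDiffOn ℝ 1 (fderivWithin ℝ f (cube N)) (cube N) :=
    hf.fderivWithin uniqueDiffOn_cube (by norm_num)
  exact (h.differentiableOn (by norm_num)).clm_apply (differentiableOn_const _)

lemma partialDeriv_neg {f : (Fin N → ℝ) → ℝ} {x : Fin N → ℝ} (hx : x ∈ cube N) (j : Fin N) :
    partialDeriv j (fun y => -f y) x = -partialDeriv j f x := by
  simp only [partialDeriv]
  rw [fderivWithin_fun_neg (uniqueDiffOn_cube x hx)]
  rfl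

end Cube

/-! ### Monotonicity and sublinearity of spreading rates -/

namespace IsSpreadingRate

variable {N : ℕ} {E : Fin N → Fin N → Prop} {f : Fin N → (Fin N → ℝ) → ℝ}

lemma differentiableOn (hf : IsSpreadingRate E f) (i : Fin N) :
    DifferentiableOn ℝ (f i) (cube N) := (hf.smooth i).differentiableOn (by norm_num)

lemma continuousOn (hf : IsSpreadingRate E f) (i : Fin N) :
    ContinuousOn (f i) (cube N) := (hf.smooth i).continuousOn

/-- In an argument on which the rate does not depend, the restriction to a coordinate line is
constant, so the partial derivative is zero. -/
lemma partialDeriv_nonneg (hf : IsSpreadingRate E f) (i j : Fin N) {x : Fin N → ℝ}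
    (hx : x ∈ cube N) : 0 ≤ partialDeriv j (f i) x := by
  by_cases hd : DependsOnArg (f i) j
  · exact (hf.monotone i j hd x hx).le
  have hxj : x j ∈ Icc (0 : ℝ) 1 := mem_cube.1 hx j
  have h1 := hasDerivWithinAt_update (hf.differentiableOn i) hx j hxj
  have hc : ∀ r ∈ Icc (0 : ℝ) 1, f i (Function.update x j r) = f i x := by
    intro r hr
    by_contra hne
    refine hd ⟨_, ?_, x, hx, ?_, hne⟩
    · refine mem_cube.2 fun i => ?_
      rcases eq_or_ne i j with rfl | hij
      · simpa using hr
      · simpa [hij] using mem_cube.1 hx i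
    · intro k hk
      simp [hk]
  have h2 : HasDerivWithinAt (fun r : ℝ => f i (Function.update x j r)) 0 (Icc 0 1) (x j) :=
    (hasDerivWithinAt_const (x j) (Icc (0 : ℝ) 1) (f i x)).congr hc (hc _ hxj)
  have := (uniqueDiffOn_Icc (zero_lt_one (α := ℝ)) _ hxj).eq_deriv _ h1 h2
  rw [Function.update_eq_self] at this
  exact this.ge

lemma monotoneOn (hf : IsSpreadingRate E f) (i : Fin N) : MonotoneOn (f i) (cube N) :=
  monotoneOn_of_partialDeriv_nonneg (hf.differentiableOn i)
    fun j _ hx => hf.partialDeriv_nonneg i j hx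

lemma nonneg (hf : IsSpreadingRate E f) (i : Fin N) {x : Fin N → ℝ} (hx : x ∈ cube N) :
    0 ≤ f i x := by
  rw [← hf.nullity i]
  exact hf.monotoneOn i zero_mem_cube hx fun j => (mem_cube.1 hx j).1

lemma antitoneOn_partialDeriv (hf : IsSpreadingRate E f) (i j : Fin N) :
    AntitoneOn (partialDeriv j (f i)) (cube N) := by
  have := monotoneOn_of_partialDeriv_nonneg
    (differentiableOn_partialDeriv (hf.smooth i) j).neg
    (fun k x hx => by
      have h := partialDeriv_neg (f := partialDeriv j (f i)) hx k
      have h2 := hf.concave i k j x hx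
      change 0 ≤ partialDeriv k (fun y => -partialDeriv j (f i) y) x
      linarith)
  intro x hx y hy hxy
  have := this hx hy hxy
  simp only [Pi.neg_apply] at this
  linarith

/-- On the `j`-th axis the rate increases strictly from its value `0` at the origin; monotonicity
passes from the axis to `x`. -/
lemma pos (hf : IsSpreadingRate E f) {i j : Fin N} (hE : E i j) {x : Fin N → ℝ}
    (hx : x ∈ cube N) (hxj : 0 < x j) : 0 < f i x := by
  have hd := (hf.proximity i j).2 hE
  have hI := mem_cube.1 hx j
  have h1 := fun t (ht : t ∈ Icc (0 : ℝ) 1) =>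
    hasDerivWithinAt_update (hf.differentiableOn i) zero_mem_cube j ht
  have hm : ∀ r ∈ Icc (0 : ℝ) 1, Function.update (0 : Fin N → ℝ) j r ∈ cube N := by
    intro r hr
    refine mem_cube.2 fun i => ?_
    rcases eq_or_ne i j with rfl | hij
    · simpa using hr
    · simp [hij]
  have h2 := strictMonoOn_of_hasDerivWithinAt_pos (convex_Icc (0 : ℝ) 1)
    (fun t ht => (h1 t ht).continuousWithinAt)
    (fun t ht => (h1 t (interior_subset ht)).mono interior_subset)
    (fun t ht => hf.monotone i j hd _ (hm t (interior_subset ht)))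
    (left_mem_Icc.2 zero_le_one) ⟨hI.1, hI.2⟩ hxj
  simp only at h2
  rw [show Function.update (0 : Fin N → ℝ) j 0 = 0 from Function.update_eq_self j 0,
    hf.nullity i] at h2
  refine h2.trans_le (hf.monotoneOn i (hm _ ⟨hI.1, hI.2⟩) hx fun k => ?_)
  rcases eq_or_ne k j with rfl | hkj
  · simp
  · simpa [hkj] using (mem_cube.1 hx k).1

lemma hasDerivWithinAt_smul (hf : IsSpreadingRate E f) (i : Fin N) {x : Fin N → ℝ}
    (hx : x ∈ cube N) {t : ℝ} (ht : t ∈ Icc (0 : ℝ) 1) :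
    HasDerivWithinAt (fun r : ℝ => f i (r • x)) (∑ j, x j * partialDeriv j (f i) (t • x))
      (Icc 0 1) t := by
  simpa using hasDerivWithinAt_line (x := 0) (hf.differentiableOn i)
    (fun t ht => by simpa using smul_mem_cube hx ht) ht

/-- Nonpositive entries do not make the Hessian negative semidefinite, so concavity is claimed only
along rays from the origin: their directions are nonnegative, and the partial derivatives decrease
along them. -/
lemma concaveOn_smul (hf : IsSpreadingRate E f) (i : Fin N) {x : Fin N → ℝ}
    (hx : x ∈ cube N) : ConcaveOn ℝ (Icc (0 : ℝ) 1) fun r : ℝ => f i (r • x) := by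
  have hd := fun t (ht : t ∈ Icc (0 : ℝ) 1) => hf.hasDerivWithinAt_smul i hx ht
  have hderiv : ∀ t ∈ interior (Icc (0 : ℝ) 1), HasDerivAt (fun r : ℝ => f i (r • x))
      (∑ j, x j * partialDeriv j (f i) (t • x)) t := fun t ht =>
    (hd t (interior_subset ht)).hasDerivAt (mem_interior_iff_mem_nhds.1 ht)
  refine AntitoneOn.concaveOn_of_deriv (convex_Icc _ _) (fun t ht => (hd t ht).continuousWithinAt)
    (fun t ht => (hderiv t ht).differentiableAt.differentiableWithinAt) ?_
  intro s hs t ht hst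
  rw [(hderiv s hs).deriv, (hderiv t ht).deriv]
  refine Finset.sum_le_sum fun j _ => mul_le_mul_of_nonneg_left ?_ (mem_cube.1 hx j).1
  refine hf.antitoneOn_partialDeriv i j (smul_mem_cube hx (interior_subset hs))
    (smul_mem_cube hx (interior_subset ht)) fun k => ?_
  exact mul_le_mul_of_nonneg_right hst (mem_cube.1 hx k).1

/-- Sublinearity: concavity along the ray together with the value `0` at the origin. -/
lemma mul_le_apply_smul (hf : IsSpreadingRate E f) (i : Fin N) {x : Fin N → ℝ}
    (hx : x ∈ cube N) {t : ℝ} (ht : t ∈ Icc (0 : ℝ) 1) : t * f i x ≤ f i (t • x) := by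
  have := (hf.concaveOn_smul i hx).2 (left_mem_Icc.2 zero_le_one) (right_mem_Icc.2 zero_le_one)
    (sub_nonneg.2 ht.2) ht.1 (by ring)
  simp only [smul_eq_mul, mul_zero, mul_one, zero_add, zero_smul, one_smul, hf.nullity i] at this
  exact this

/-- The difference quotients at the origin converge to the directional derivative. -/
lemma tendsto_smul_div (hf : IsSpreadingRate E f) (i : Fin N) {x : Fin N → ℝ}
    (hx : x ∈ cube N) :
    Tendsto (fun t : ℝ => f i (t • x) / t) (𝓝[>] 0) (𝓝 (∑ j, jacobianAtZero f i j * x j)) := by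
  have h := (hf.hasDerivWithinAt_smul i hx (left_mem_Icc.2 zero_le_one)).mono_of_mem_nhdsWithin
    (Icc_mem_nhdsGT (zero_lt_one (α := ℝ)))
  have h2 := (hasDerivWithinAt_iff_tendsto_slope' self_notMem_Ioi).1 h
  refine (h2.congr fun t => ?_).trans_eq ?_
  · simp [slope, hf.nullity i, div_eq_inv_mul]
  · simp [jacobianAtZero, mul_comm]

/-- By sublinearity every quotient `f (t x) / t` with `0 < t ≤ 1` is at least `f x`; let `t → 0`. -/
lemma apply_le_jacobian (hf : IsSpreadingRate E f) (i : Fin N) {x : Fin N → ℝ}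
    (hx : x ∈ cube N) : f i x ≤ ∑ j, jacobianAtZero f i j * x j := by
  refine ge_of_tendsto (hf.tendsto_smul_div i hx) ?_
  filter_upwards [Ioc_mem_nhdsGT (zero_lt_one (α := ℝ))] with t ht
  rw [le_div_iff₀ ht.1, mul_comm]
  exact hf.mul_le_apply_smul i hx ⟨ht.1.le, ht.2⟩

lemma jacobianAtZero_nonneg (hf : IsSpreadingRate E f) (i j : Fin N) :
    0 ≤ jacobianAtZero f i j := hf.partialDeriv_nonneg i j zero_mem_cube

end IsSpreadingRate

/-! ### Maximal real part of matrices with nonnegative off-diagonal entries -/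

section MaxRealPart

variable {N : ℕ} {Q : Matrix (Fin N) (Fin N) ℝ}

lemma hasEigenvalue_toLin'_map_iff {c : ℂ} {A : Matrix (Fin N) (Fin N) ℂ} :
    Module.End.HasEigenvalue (Matrix.toLin' A) c ↔ ∃ z, z ≠ 0 ∧ A.mulVec z = c • z := by
  constructor
  · intro h
    obtain ⟨z, hz⟩ := h.exists_hasEigenvector
    exact ⟨z, hz.2, by simpa using hz.apply_eq_smul⟩
  · rintro ⟨z, hz, h⟩
    exact Module.End.hasEigenvalue_of_hasEigenvector
      ⟨Module.End.mem_eigenspace_iff.2 (by simpa using h), hz⟩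

/-- A matrix with nonnegative off-diagonal entries and positive maximal real part has a
nonnegative vector that it expands. -/
lemma exists_expanded_vector (hQ : ∀ i j, i ≠ j → 0 ≤ Q i j) (h : 0 < maxRealPart Q) :
    ∃ v : Fin N → ℝ, (∀ i, 0 ≤ v i) ∧ v ≠ 0 ∧ ∃ ε > 0, ∀ i, ε * v i ≤ Q.mulVec v i := by
  obtain ⟨μ, hμ, hre⟩ : ∃ μ : ℂ,
      Module.End.HasEigenvalue (Matrix.toLin' (Q.map (fun r : ℝ => (r : ℂ)))) μ ∧ 0 < μ.re := by
    by_contra hcon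
    push Not at hcon
    refine absurd h (not_lt.2 (Real.sSup_nonpos ?_))
    rintro _ ⟨μ, hμ, rfl⟩
    exact hcon μ hμ
  obtain ⟨z, hz, hQz⟩ := hasEigenvalue_toLin'_map_iff.1 hμ
  refine ⟨fun i => ‖z i‖, fun i => norm_nonneg _, fun h0 => hz ?_, μ.re, hre, fun i => ?_⟩
  · ext i
    simpa using congrFun h0 i
  -- The diagonal entry may be negative, so it is moved to the left before the triangle inequality;
  -- there `|μ - Q i i| ≥ Re μ - Q i i`.
  · have e : (μ - Q i i) * z i = ∑ j ∈ Finset.univ.erase i, (Q i j : ℂ) * z j := by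
      have := congrFun hQz i
      simp only [Matrix.mulVec, dotProduct, Matrix.map_apply, Pi.smul_apply, smul_eq_mul] at this
      rw [← Finset.add_sum_erase _ _ (Finset.mem_univ i)] at this
      rw [sub_mul, ← this]
      ring
    have h1 : ‖(μ - Q i i) * z i‖ ≤ ∑ j ∈ Finset.univ.erase i, Q i j * ‖z j‖ := by
      rw [e]
      refine (norm_sum_le _ _).trans (Finset.sum_le_sum fun j hj => ?_)
      rw [norm_mul, Complex.norm_real, Real.norm_of_nonneg (hQ i j (Finset.ne_of_mem_erase hj).symm)]
    have h2 : μ.re - Q i i ≤ ‖μ - Q i i‖ := by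
      simpa using Complex.re_le_norm (μ - Q i i)
    rw [norm_mul] at h1
    have h3 := mul_le_mul_of_nonneg_right h2 (norm_nonneg (z i))
    simp only [Matrix.mulVec, dotProduct]
    rw [← Finset.add_sum_erase _ _ (Finset.mem_univ i)]
    linarith

attribute [local instance] Matrix.linftyOpNormedRing Matrix.linftyOpNormedAlgebra

lemma pow_mul_le_pow_mulVec {P : Matrix (Fin N) (Fin N) ℝ} (hP : ∀ i j, 0 ≤ P i j)
    {u : Fin N → ℝ} {r : ℝ} (hr : 0 ≤ r) (h : ∀ i, r * u i ≤ P.mulVec u i) (n : ℕ) (i : Fin N) :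
    r ^ n * u i ≤ (P ^ n).mulVec u i := by
  induction n generalizing i with
  | zero => simp
  | succ n ih =>
    rw [pow_succ', pow_succ' P, ← Matrix.mulVec_mulVec]
    calc r * r ^ n * u i = r ^ n * (r * u i) := by ring
      _ ≤ r ^ n * P.mulVec u i := mul_le_mul_of_nonneg_left (h i) (by positivity)
      _ = ∑ j, P i j * (r ^ n * u j) := by
        simp only [Matrix.mulVec, dotProduct, Finset.mul_sum]
        exact Finset.sum_congr rfl fun j _ => by ring
      _ ≤ _ := Finset.sum_le_sum fun j _ => mul_le_mul_of_nonneg_left (ih j) (hP i j)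

/-- A nonnegative matrix that expands a nonnegative vector by a factor `r` has a complex
eigenvalue of modulus at least `r`. -/
lemma exists_eigenvalue_norm_ge {P : Matrix (Fin N) (Fin N) ℝ} (hP : ∀ i j, 0 ≤ P i j)
    {u : Fin N → ℝ} (hu : ∀ i, 0 ≤ u i) (hu0 : u ≠ 0) {r : ℝ} (hr : 0 ≤ r)
    (h : ∀ i, r * u i ≤ P.mulVec u i) :
    ∃ c : ℂ, Module.End.HasEigenvalue (Matrix.toLin' (P.map (fun r : ℝ => (r : ℂ)))) c ∧
      r ≤ ‖c‖ := by
  obtain ⟨i, hi⟩ : ∃ i, u i ≠ 0 := Function.ne_iff.1 hu0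
  have hui : 0 < u i := (hu i).lt_of_ne' hi
  have : Nonempty (Fin N) := ⟨i⟩
  have : CompleteSpace (Matrix (Fin N) (Fin N) ℂ) := FiniteDimensional.complete ℂ _
  set A : Matrix (Fin N) (Fin N) ℂ := P.map (fun r : ℝ => (r : ℂ)) with hA
  set w : Fin N → ℂ := fun i => (u i : ℂ) with hw
  have hw0 : 0 < ‖w‖ := norm_pos_iff.2 fun h0 => hi (by simpa [hw] using congrFun h0 i)
  set K := u i / ‖w‖ with hK
  have hK0 : 0 < K := div_pos hui hw0
  have hpow : ∀ n : ℕ, r ^ n * K ≤ ‖A ^ n‖ := by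
    intro n
    have h1 : A ^ n = (P ^ n).map (fun r : ℝ => (r : ℂ)) := by
      have := map_pow (Complex.ofRealHom.mapMatrix (m := Fin N)) P n
      exact this.symm
    have h2 : (A ^ n).mulVec w i = (((P ^ n).mulVec u i : ℝ) : ℂ) := by
      rw [h1]
      simp [Matrix.mulVec, dotProduct, hw]
    have h3 : ‖(A ^ n).mulVec w i‖ ≤ ‖A ^ n‖ * ‖w‖ :=
      (norm_le_pi_norm _ i).trans (Matrix.linfty_opNorm_mulVec _ _)
    rw [h2, Complex.norm_real] at h3
    have h4 := (pow_mul_le_pow_mulVec hP hr h n i).trans ((le_abs_self _).trans h3)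
    rw [hK, ← mul_div_assoc, div_le_iff₀ hw0]
    exact h4
  -- Gelfand's formula turns `r ^ n * K ≤ ‖A ^ n‖` into a bound on the spectral radius, since `K ^
  -- (1 / n) → 1`; the radius is attained by an eigenvalue.
  obtain ⟨c, hc, hcr⟩ := spectrum.exists_nnnorm_eq_spectralRadius A
  refine ⟨c, ?_, ?_⟩
  · rw [Module.End.hasEigenvalue_iff_mem_spectrum, Matrix.spectrum_toLin']
    exact hc
  have hlim := spectrum.pow_norm_pow_one_div_tendsto_nhds_spectralRadius A
  have hlim2 : Tendsto (fun n : ℕ => ENNReal.ofReal (r * K ^ (1 / n : ℝ))) atTop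
      (𝓝 (ENNReal.ofReal r)) := by
    refine (ENNReal.continuous_ofReal.tendsto _).comp ?_
    have : Tendsto (fun n : ℕ => K ^ (1 / n : ℝ)) atTop (𝓝 (K ^ (0 : ℝ))) :=
      ((Real.continuousAt_const_rpow hK0.ne').tendsto).comp tendsto_one_div_atTop_nhds_zero_nat
    simpa using this.const_mul r
  have hle := le_of_tendsto_of_tendsto hlim2 hlim (by
    filter_upwards [eventually_gt_atTop 0] with n hn
    refine ENNReal.ofReal_le_ofReal ?_
    have hn' : (n : ℝ) ≠ 0 := by positivity
    calc r * K ^ (1 / n : ℝ) = (r ^ n * K) ^ (1 / n : ℝ) := by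
          rw [Real.mul_rpow (by positivity) hK0.le, one_div, Real.pow_rpow_inv_natCast hr hn.ne']
      _ ≤ _ := Real.rpow_le_rpow (by positivity) (hpow n) (by positivity))
  rw [← hcr, ENNReal.ofReal_le_iff_le_toReal (by simp)] at hle
  simpa using hle

lemma maxRealPart_pos (hQ : ∀ i j, i ≠ j → 0 ≤ Q i j) {u : Fin N → ℝ} (hu : ∀ i, 0 ≤ u i)
    (hu0 : u ≠ 0) {ε : ℝ} (hε : 0 < ε) (h : ∀ i, ε * u i ≤ Q.mulVec u i) :
    0 < maxRealPart Q := by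
  set S : Set ℂ :=
    {μ : ℂ | Module.End.HasEigenvalue (Matrix.toLin' (Q.map (fun r : ℝ => (r : ℂ)))) μ} with hS
  have hfin : S.Finite := Module.End.finite_hasEigenvalue _
  obtain ⟨B, hB⟩ := hfin.isBounded.exists_norm_le
  -- Shifting by a large `c` makes the matrix nonnegative, with an eigenvalue `μ` of modulus at
  -- least `c + ε`. If `ν = μ - c` had `Re ν ≤ 0`, then `|μ|² ≤ |ν|² + c² ≤ B² + c²`, which the
  -- choice of `c` puts below `(c + ε)²`.
  obtain ⟨c, hc0, hcB, hcQ⟩ : ∃ c : ℝ, 0 < c ∧ B ^ 2 < 2 * c * ε ∧ ∀ i, 0 ≤ Q i i + c := by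
    have h1 : ∀ᶠ c : ℝ in atTop, ∀ i, 0 ≤ Q i i + c := eventually_all.2 fun i => by
      filter_upwards [eventually_ge_atTop (-Q i i)] with c hc
      linarith
    obtain ⟨c, hc⟩ := ((eventually_gt_atTop 0).and
      ((eventually_gt_atTop (B ^ 2 / (2 * ε))).and h1)).exists
    refine ⟨c, hc.1, ?_, hc.2.2⟩
    have := (div_lt_iff₀ (by positivity)).1 hc.2.1
    linarith
  obtain ⟨μ, hμ, hn⟩ := exists_eigenvalue_norm_ge (P := Q + Matrix.diagonal fun _ => c) (r := c + ε)
    (fun i j => by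
      rcases eq_or_ne i j with rfl | hij
      · simpa using hcQ i
      · simpa [hij] using hQ i j hij) hu hu0 (by positivity) (fun i => by
        rw [Matrix.add_mulVec, Pi.add_apply, Matrix.mulVec_diagonal]
        linarith [h i])
  obtain ⟨z, hz, hPz⟩ := hasEigenvalue_toLin'_map_iff.1 hμ
  have hν : μ - c ∈ S := by
    refine hasEigenvalue_toLin'_map_iff.2 ⟨z, hz, ?_⟩
    rw [Matrix.map_add _ (by simp), Matrix.diagonal_map (by simp), Matrix.add_mulVec] at hPz
    ext i
    have := congrFun hPz i
    simp only [Pi.add_apply, Matrix.mulVec_diagonal, Pi.smul_apply, smul_eq_mul] at this ⊢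
    rw [sub_mul, ← this]
    ring
  have hre : 0 < (μ - c).re := by
    have h1 := hB _ hν
    have h2 : ‖μ - c‖ ^ 2 ≤ B ^ 2 := pow_le_pow_left₀ (norm_nonneg _) h1 2
    have h3 : (c + ε) ^ 2 ≤ ‖μ‖ ^ 2 := pow_le_pow_left₀ (by positivity) hn 2
    rw [← Complex.normSq_eq_norm_sq, Complex.normSq_apply] at h2 h3
    simp only [Complex.sub_re, Complex.ofReal_re, Complex.sub_im, Complex.ofReal_im,
      sub_zero] at h2 ⊢
    by_contra hneg
    push Not at hneg
    nlinarith
  exact hre.trans_le (le_csSup (hfin.image _).bddAbove ⟨_, hν, rfl⟩)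

end MaxRealPart

/-! ### Global existence, and invariance of `Ω` -/

/-- A bounded, globally Lipschitz autonomous vector field has solutions on `[0, ∞)`. -/
lemma exists_global_solution {V : Type*} [NormedAddCommGroup V] [NormedSpace ℝ V]
    [CompleteSpace V] {F : V → V} {K L : NNReal} (hF : LipschitzWith K F) (hL : ∀ x, ‖F x‖ ≤ L)
    (x₀ : V) :
    ∃ x : ℝ → V, x 0 = x₀ ∧ ∀ t, 0 ≤ t → HasDerivWithinAt x (F (x t)) (Ici 0) t := by
  have hex : ∀ n : ℕ, ∃ α : ℝ → V, α 0 = x₀ ∧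
      ∀ t ∈ Icc (0 : ℝ) n, HasDerivWithinAt α (F (α t)) (Icc 0 n) t := by
    intro n
    have hpl : IsPicardLindelof (fun _ => F) (tmin := 0) (tmax := n)
        ⟨0, left_mem_Icc.2 n.cast_nonneg⟩ x₀ (L * n) 0 L K :=
      IsPicardLindelof.of_time_independent (fun x _ => hL x) hF.lipschitzOnWith (by simp)
    exact hpl.exists_eq_forall_mem_Icc_hasDerivWithinAt₀
  choose α hα0 hα using hex
  have huniq : ∀ m n : ℕ, m ≤ n → EqOn (α m) (α n) (Icc 0 m) := by
    intro m n hmn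
    have hmn' : (m : ℝ) ≤ n := Nat.cast_le.2 hmn
    have hd : ∀ t ∈ Icc (0 : ℝ) m, HasDerivWithinAt (α n) (F (α n t)) (Icc 0 m) t := fun t ht =>
      (hα n t ⟨ht.1, ht.2.trans hmn'⟩).mono (Icc_subset_Icc_right hmn')
    have hI : ∀ t ∈ Ico (0 : ℝ) m, Icc 0 (m : ℝ) ∈ 𝓝[Ici t] t := fun t ht =>
      mem_of_superset (Icc_mem_nhdsGE ht.2) (Icc_subset_Icc_left ht.1)
    exact ODE_solution_unique (v := fun _ => F) (fun _ => hF)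
      (fun t ht => (hα m t ht).continuousWithinAt)
      (fun t ht => (hα m t ⟨ht.1, ht.2.le⟩).mono_of_mem_nhdsWithin (hI t ht))
      (fun t ht => (hd t ht).continuousWithinAt)
      (fun t ht => (hd t ⟨ht.1, ht.2.le⟩).mono_of_mem_nhdsWithin (hI t ht))
      ((hα0 m).trans (hα0 n).symm)
  have heq : ∀ m n : ℕ, ∀ t : ℝ, 0 ≤ t → t ≤ m → t ≤ n → α m t = α n t := by
    intro m n t h0 hm hn
    rcases le_total m n with h | h
    · exact huniq m n h ⟨h0, hm⟩
    · exact (huniq n m h ⟨h0, hn⟩).symm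
  have hceil : ∀ t : ℝ, t < ((⌈t⌉₊ + 1 : ℕ) : ℝ) := fun t => by
    push_cast
    linarith [Nat.le_ceil t]
  -- The `+ 1` makes `t` lie strictly before the end of the chosen interval, so that a one-sided
  -- neighbourhood of `t` in `[0, ∞)` is covered.
  refine ⟨fun t => α (⌈t⌉₊ + 1) t, hα0 _, fun t ht => ?_⟩
  have h1 : HasDerivWithinAt (fun s => α (⌈s⌉₊ + 1) s) (F (α (⌈t⌉₊ + 1) t))
      (Icc 0 ((⌈t⌉₊ + 1 : ℕ) : ℝ)) t :=
    (hα (⌈t⌉₊ + 1) t ⟨ht, (hceil t).le⟩).congr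
      (fun s hs => heq _ _ s hs.1 (hceil s).le hs.2) rfl
  exact h1.mono_of_mem_nhdsWithin
    (mem_nhdsWithin.2 ⟨Iio _, isOpen_Iio, hceil t, fun s hs => ⟨hs.2, hs.1.le⟩⟩)

section State

variable {N : ℕ}

lemma fst_mem_cube_of_mem_Ω {x : State N} (hx : x ∈ Ω N) : x.1 ∈ cube N :=
  mem_cube.2 fun i => ⟨hx.1 i, by linarith [hx.2.1 i, hx.2.2 i]⟩

lemma snd_mem_cube_of_mem_Ω {x : State N} (hx : x ∈ Ω N) : x.2 ∈ cube N :=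
  mem_cube.2 fun i => ⟨hx.2.1 i, by linarith [hx.1 i, hx.2.2 i]⟩

lemma hasDerivWithinAt_fst_apply {x : ℝ → State N} {x' : State N} {s : Set ℝ} {t : ℝ}
    (h : HasDerivWithinAt x x' s t) (i : Fin N) :
    HasDerivWithinAt (fun r => (x r).1 i) (x'.1 i) s t :=
  hasDerivWithinAt_pi.1 ((ContinuousLinearMap.fst ℝ (Fin N → ℝ) (Fin N → ℝ)).hasFDerivAt
    |>.comp_hasDerivWithinAt t h) i

lemma hasDerivWithinAt_snd_apply {x : ℝ → State N} {x' : State N} {s : Set ℝ} {t : ℝ}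
    (h : HasDerivWithinAt x x' s t) (i : Fin N) :
    HasDerivWithinAt (fun r => (x r).2 i) (x'.2 i) s t :=
  hasDerivWithinAt_pi.1 ((ContinuousLinearMap.snd ℝ (Fin N → ℝ) (Fin N → ℝ)).hasFDerivAt
    |>.comp_hasDerivWithinAt t h) i

/-- A Lipschitz retraction of the state space onto `Ω`. -/
def retract (x : State N) : State N :=
  (fun i => max 0 (min (x.1 i) 1),
   fun i => max 0 (min (x.2 i) (1 - max 0 (min (x.1 i) 1))))

lemma retract_mem_Ω (x : State N) : retract x ∈ Ω N := by
  refine ⟨fun i => le_max_left _ _, fun i => le_max_left _ _, fun i => ?_⟩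
  simp only [retract]
  have h1 : max 0 (min (x.1 i) 1) ≤ 1 := max_le zero_le_one (min_le_right _ _)
  have h2 : max 0 (min (x.2 i) (1 - max 0 (min (x.1 i) 1))) ≤ 1 - max 0 (min (x.1 i) 1) :=
    max_le (by linarith) (min_le_right _ _)
  linarith

lemma retract_of_mem_Ω {x : State N} (hx : x ∈ Ω N) : retract x = x := by
  have h : ∀ i, max 0 (min (x.1 i) 1) = x.1 i := fun i => by
    rw [min_eq_left (mem_cube.1 (fst_mem_cube_of_mem_Ω hx) i).2, max_eq_right (hx.1 i)]
  refine Prod.ext (funext h) (funext fun i => ?_)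
  simp only [retract]
  rw [h, min_eq_left (by linarith [hx.2.2 i]), max_eq_right (hx.2.1 i)]

lemma exists_lipschitzWith_retract : ∃ K, LipschitzWith K (retract (N := N)) := by
  have h1 : ∀ i, LipschitzWith 1 fun x : State N => max 0 (min (x.1 i) 1) := fun i => by
    simpa using (((LipschitzWith.eval (α := fun _ => ℝ) i).comp
      LipschitzWith.prod_fst).min_const 1).const_max 0
  have h2 : ∀ i, LipschitzWith 1 fun x : State N =>
      max 0 (min (x.2 i) (1 - max 0 (min (x.1 i) 1))) := fun i => by
    have h3 : LipschitzWith 1 fun x : State N => 1 - max 0 (min (x.1 i) 1) := by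
      simpa using (LipschitzWith.const (1 : ℝ)).sub (h1 i)
    simpa using (((LipschitzWith.eval (α := fun _ => ℝ) i).comp
      LipschitzWith.prod_snd).min h3).const_max 0
  have hpi : ∀ {g : State N → Fin N → ℝ}, (∀ i, LipschitzWith 1 fun x => g x i) →
      LipschitzWith 1 g := fun h => LipschitzWith.of_dist_le_mul fun x y =>
    (dist_pi_le_iff (by positivity)).2 fun i => (h i).dist_le_mul x y
  exact ⟨_, (hpi h1).prodMk (hpi h2)⟩

end State

namespace Model

variable {N : ℕ} (M : Model N)

lemma contDiffOn_field : ContDiffOn ℝ 2 M.field (cube N ×ˢ cube N) := by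
  have hR : ∀ i, ContDiffOn ℝ 2 (fun x : State N => x.1 i) (cube N ×ˢ cube N) := fun i =>
    ((contDiff_apply ℝ ℝ i).comp contDiff_fst).contDiffOn
  have hT : ∀ i, ContDiffOn ℝ 2 (fun x : State N => x.2 i) (cube N ×ˢ cube N) := fun i =>
    ((contDiff_apply ℝ ℝ i).comp contDiff_snd).contDiffOn
  have h1 : ∀ {f : (Fin N → ℝ) → ℝ}, ContDiffOn ℝ 2 f (cube N) →
      ContDiffOn ℝ 2 (fun x : State N => f x.1) (cube N ×ˢ cube N) := fun hf =>
    hf.comp contDiff_fst.contDiffOn fun x hx => hx.1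
  have h2 : ∀ {f : (Fin N → ℝ) → ℝ}, ContDiffOn ℝ 2 f (cube N) →
      ContDiffOn ℝ 2 (fun x : State N => f x.2) (cube N ×ˢ cube N) := fun hf =>
    hf.comp contDiff_snd.contDiffOn fun x hx => hx.2
  refine ContDiffOn.prodMk (contDiffOn_pi.2 fun i => ?_) (contDiffOn_pi.2 fun i => ?_)
  · exact ((((contDiffOn_const.sub (hR i)).sub (hT i)).mul (h1 (M.fU_rate.smooth i))).sub
      (contDiffOn_const.mul (hR i))).add ((hT i).mul (h1 (M.fT_rate.smooth i))) |>.sub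
      ((hR i).mul (h2 (M.gR_rate.smooth i)))
  · exact ((((contDiffOn_const.sub (hR i)).sub (hT i)).mul (h2 (M.gU_rate.smooth i))).sub
      (contDiffOn_const.mul (hT i))).add ((hR i).mul (h2 (M.gR_rate.smooth i))) |>.sub
      ((hT i).mul (h1 (M.fT_rate.smooth i)))

variable {M}

lemma field_fst_nonneg {x : State N} (hx : x ∈ Ω N) {i : Fin N} (hi : x.1 i = 0) :
    0 ≤ (M.field x).1 i := by
  have h1 := mul_nonneg (sub_nonneg.2 (hx.2.2 i)) (M.fU_rate.nonneg i (fst_mem_cube_of_mem_Ω hx))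
  have h2 := mul_nonneg (hx.2.1 i) (M.fT_rate.nonneg i (fst_mem_cube_of_mem_Ω hx))
  simp only [field, hi] at h1 ⊢
  linarith

lemma field_snd_nonneg {x : State N} (hx : x ∈ Ω N) {i : Fin N} (hi : x.2 i = 0) :
    0 ≤ (M.field x).2 i := by
  have h1 := mul_nonneg (sub_nonneg.2 (hx.2.2 i)) (M.gU_rate.nonneg i (snd_mem_cube_of_mem_Ω hx))
  have h2 := mul_nonneg (hx.1 i) (M.gR_rate.nonneg i (snd_mem_cube_of_mem_Ω hx))
  simp only [field, hi] at h1 ⊢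
  linarith

/-- The terms of `fT` and `gR` cancel in the sum. Membership in the cubes replaces membership in
`Ω`, because the lemma serves to exclude `R i + T i > 1`. -/
lemma field_add_nonpos {x : State N} (h1 : x.1 ∈ cube N) (h2 : x.2 ∈ cube N) {i : Fin N}
    (hi : 1 ≤ x.1 i + x.2 i) : (M.field x).1 i + (M.field x).2 i ≤ 0 := by
  have e1 := mul_nonneg (sub_nonneg.2 hi) (M.fU_rate.nonneg i h1)
  have e2 := mul_nonneg (sub_nonneg.2 hi) (M.gU_rate.nonneg i h2)
  have e3 := mul_nonneg (M.δR_pos i).le (mem_cube.1 h1 i).1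
  have e4 := mul_nonneg (M.δT_pos i).le (mem_cube.1 h2 i).1
  simp only [field]
  linarith

/-- From each admissible state there starts a global solution. -/
lemma exists_isSolution {x₀ : State N} (hx₀ : x₀ ∈ Ω N) : ∃ x, M.IsSolution x ∧ x 0 = x₀ := by
  have hcomp : IsCompact (cube N ×ˢ cube N) := isCompact_cube.prod isCompact_cube
  have hmaps : ∀ x : State N, retract x ∈ cube N ×ˢ cube N := fun x =>
    ⟨fst_mem_cube_of_mem_Ω (retract_mem_Ω x), snd_mem_cube_of_mem_Ω (retract_mem_Ω x)⟩
  obtain ⟨K, hK⟩ := M.contDiffOn_field.exists_lipschitzOnWith (by norm_num)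
    (convex_cube.prod convex_cube) hcomp
  obtain ⟨K', hK'⟩ := exists_lipschitzWith_retract (N := N)
  obtain ⟨L, hL⟩ := hcomp.exists_bound_of_continuousOn M.contDiffOn_field.continuousOn
  have hlip : LipschitzWith (K * K') fun x => M.field (retract x) :=
    lipschitzOnWith_univ.1 (hK.comp hK'.lipschitzOnWith fun x _ => hmaps x)
  obtain ⟨x, hx0, hx⟩ := exists_global_solution (L := L.toNNReal) hlip
    (fun x => (hL _ (hmaps x)).trans (Real.le_coe_toNNReal L)) x₀
  have hΩ : ∀ t, 0 ≤ t → x t ∈ Ω N := by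
    intro t ht
    refine ⟨fun i => ?_, fun i => ?_, fun i => ?_⟩
    · refine nonneg_of_deriv_nonneg_of_neg (y := fun t => (x t).1 i)
        (fun t ht => hasDerivWithinAt_fst_apply (hx t ht) i) (by simpa [hx0] using hx₀.1 i) ?_ t ht
      intro t ht hneg
      refine field_fst_nonneg (retract_mem_Ω _) ?_
      exact max_eq_left ((min_le_left _ _).trans hneg.le)
    · refine nonneg_of_deriv_nonneg_of_neg (y := fun t => (x t).2 i)
        (fun t ht => hasDerivWithinAt_snd_apply (hx t ht) i)
        (by simpa [hx0] using hx₀.2.1 i) ?_ t ht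
      intro t ht hneg
      refine field_snd_nonneg (retract_mem_Ω _) ?_
      exact max_eq_left ((min_le_left _ _).trans hneg.le)
    · have := nonneg_of_deriv_nonneg_of_neg (y := fun t => 1 - ((x t).1 i + (x t).2 i))
        (fun t ht => ((hasDerivWithinAt_fst_apply (hx t ht) i).add
          (hasDerivWithinAt_snd_apply (hx t ht) i)).const_sub 1)
        (by simpa [hx0] using hx₀.2.2 i) (fun t ht hneg => ?_) t ht
      · linarith
      · rw [neg_nonneg]
        refine field_add_nonpos (hmaps _).1 (hmaps _).2 ?_
        -- Where `R i + T i > 1`, the retracted state has coordinate sum at least `1`.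
        simp only [retract]
        rcases le_total ((x t).1 i) 0 with h | h
        · rw [max_eq_left ((min_le_left _ _).trans h), sub_zero, min_eq_right (by linarith)]
          simp
        · rcases le_total ((x t).1 i) 1 with h' | h'
          · rw [min_eq_left h', max_eq_right h, min_eq_right (by linarith),
              max_eq_right (by linarith)]
            linarith
          · rw [min_eq_right h', max_eq_right zero_le_one]
            linarith [le_max_left 0 (min ((x t).2 i) (1 - 1))]
  refine ⟨x, fun t ht => ⟨fst_mem_cube_of_mem_Ω (hΩ t ht), snd_mem_cube_of_mem_Ω (hΩ t ht), ?_⟩,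
    hx0⟩
  have := hx t ht
  rwa [retract_of_mem_Ω (hΩ t ht)] at this

namespace IsSolution

variable {x : ℝ → State N}

lemma hasDerivWithinAt_fst (hx : M.IsSolution x) {t : ℝ} (ht : 0 ≤ t) (i : Fin N) :
    HasDerivWithinAt (fun t => (x t).1 i) ((M.field (x t)).1 i) (Ici 0) t :=
  hasDerivWithinAt_fst_apply (hx t ht).2.2 i

lemma hasDerivWithinAt_snd (hx : M.IsSolution x) {t : ℝ} (ht : 0 ≤ t) (i : Fin N) :
    HasDerivWithinAt (fun t => (x t).2 i) ((M.field (x t)).2 i) (Ici 0) t :=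
  hasDerivWithinAt_snd_apply (hx t ht).2.2 i

/-- Solutions that start in `Ω` stay there. -/
lemma mem_Ω (hx : M.IsSolution x) (h0 : x 0 ∈ Ω N) {t : ℝ} (ht : 0 ≤ t) : x t ∈ Ω N := by
  refine ⟨fun i => (mem_cube.1 (hx t ht).1 i).1, fun i => (mem_cube.1 (hx t ht).2.1 i).1,
    fun i => ?_⟩
  have := nonneg_of_deriv_nonneg_of_neg (y := fun t => 1 - ((x t).1 i + (x t).2 i))
    (fun t ht => ((hx.hasDerivWithinAt_fst ht i).add (hx.hasDerivWithinAt_snd ht i)).const_sub 1)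
    (by simpa using h0.2.2 i) (fun t ht hneg => by
      rw [neg_nonneg]
      exact field_add_nonpos (hx t ht).1 (hx t ht).2.1 (by linarith)) t ht
  linarith

end IsSolution

end Model

/-! ### Upper and lower limits of bounded functions -/

section Bounded

variable {y : ℝ → ℝ}

lemma eventually_lt_limsup_add (hy : ∀ᶠ t in atTop, y t ∈ Icc (0 : ℝ) 1) {ε : ℝ} (hε : 0 < ε) :
    ∀ᶠ t in atTop, y t < limsup y atTop + ε :=
  eventually_lt_of_limsup_lt (by linarith) (isBoundedUnder_of_eventually_le (hy.mono fun _ h => h.2))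

lemma eventually_liminf_sub_lt (hy : ∀ᶠ t in atTop, y t ∈ Icc (0 : ℝ) 1) {ε : ℝ} (hε : 0 < ε) :
    ∀ᶠ t in atTop, liminf y atTop - ε < y t :=
  eventually_lt_of_lt_liminf (by linarith) (isBoundedUnder_of_eventually_ge (hy.mono fun _ h => h.1))

lemma limsup_le_of_eventually_le (hy : ∀ᶠ t in atTop, y t ∈ Icc (0 : ℝ) 1) {c : ℝ}
    (h : ∀ᶠ t in atTop, y t ≤ c) : limsup y atTop ≤ c :=
  limsup_le_of_le (isBoundedUnder_of_eventually_ge (hy.mono fun _ h => h.1)).isCoboundedUnder_le h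

lemma le_liminf_of_eventually_le (hy : ∀ᶠ t in atTop, y t ∈ Icc (0 : ℝ) 1) {c : ℝ}
    (h : ∀ᶠ t in atTop, c ≤ y t) : c ≤ liminf y atTop :=
  le_liminf_of_le (isBoundedUnder_of_eventually_le (hy.mono fun _ h => h.2)).isCoboundedUnder_ge h

lemma liminf_le_limsup_of_mem_Icc (hy : ∀ᶠ t in atTop, y t ∈ Icc (0 : ℝ) 1) :
    liminf y atTop ≤ limsup y atTop :=
  liminf_le_limsup (isBoundedUnder_of_eventually_le (hy.mono fun _ h => h.2))
    (isBoundedUnder_of_eventually_ge (hy.mono fun _ h => h.1))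

lemma limsup_mem_Icc (hy : ∀ᶠ t in atTop, y t ∈ Icc (0 : ℝ) 1) :
    limsup y atTop ∈ Icc (0 : ℝ) 1 :=
  ⟨(le_liminf_of_eventually_le hy (hy.mono fun _ h => h.1)).trans (liminf_le_limsup_of_mem_Icc hy),
    limsup_le_of_eventually_le hy (hy.mono fun _ h => h.2)⟩

lemma liminf_mem_Icc (hy : ∀ᶠ t in atTop, y t ∈ Icc (0 : ℝ) 1) :
    liminf y atTop ∈ Icc (0 : ℝ) 1 :=
  ⟨le_liminf_of_eventually_le hy (hy.mono fun _ h => h.1),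
    (liminf_le_limsup_of_mem_Icc hy).trans (limsup_mem_Icc hy).2⟩

lemma tendsto_of_limsup_le_liminf (hy : ∀ᶠ t in atTop, y t ∈ Icc (0 : ℝ) 1) {c : ℝ}
    (h1 : limsup y atTop ≤ c) (h2 : c ≤ liminf y atTop) : Tendsto y atTop (𝓝 c) :=
  tendsto_of_le_liminf_of_limsup_le h2 h1
    (isBoundedUnder_of_eventually_le (hy.mono fun _ h => h.2))
    (isBoundedUnder_of_eventually_ge (hy.mono fun _ h => h.1))

end Bounded

/-! ### Sub- and supersolutions of the equilibrium equations -/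

namespace IsSpreadingRate

variable {N : ℕ} {E : Fin N → Fin N → Prop} {f : Fin N → (Fin N → ℝ) → ℝ} {δ : Fin N → ℝ}
  {y y' : ℝ → Fin N → ℝ}

/-- The upper limits of a family of differential inequalities form a subsolution of the
equilibrium equations. -/
lemma limsup_subsolution (hf : IsSpreadingRate E f) (hδ : ∀ i, 0 < δ i)
    (hc : ∀ t, 0 ≤ t → y t ∈ cube N)
    (hy : ∀ t, 0 ≤ t → ∀ i, HasDerivWithinAt (fun t => y t i) (y' t i) (Ici 0) t)
    (h : ∀ t, 0 ≤ t → ∀ i, y' t i ≤ (1 - y t i) * f i (y t) - δ i * y t i) (i : Fin N) :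
    δ i * limsup (fun t => y t i) atTop ≤ (1 - limsup (fun t => y t i) atTop) *
      f i fun j => limsup (fun t => y t j) atTop := by
  have hI : ∀ j, ∀ᶠ t in atTop, y t j ∈ Icc (0 : ℝ) 1 := fun j => by
    filter_upwards [eventually_ge_atTop 0] with t ht
    exact mem_cube.1 (hc t ht) j
  set u : Fin N → ℝ := fun j => limsup (fun t => y t j) atTop with hu
  have huI : ∀ j, u j ∈ Icc (0 : ℝ) 1 := fun j => limsup_mem_Icc (hI j)
  have huc : u ∈ cube N := mem_cube.2 huI
  let z : ℝ → Fin N → ℝ := fun ε j => min (u j + ε) 1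
  have hz : ∀ ε, 0 < ε → z ε ∈ cube N := fun ε hε =>
    mem_cube.2 fun j => ⟨le_min (by linarith [(huI j).1]) zero_le_one, min_le_right _ _⟩
  -- Eventually `y ≤ z ε`, so with `γ = f i (z ε)` one has `y i' ≤ γ - (γ + δ i) y i`, a linear
  -- inequality with limit value `γ / (γ + δ i)`. The cut-off at `1` keeps `z ε` in the cube.
  have key : ∀ ε, 0 < ε → u i ≤ f i (z ε) / (f i (z ε) + δ i) + ε := by
    intro ε hε
    have hγ := hf.nonneg i (hz ε hε)
    have hev : ∀ᶠ t in atTop, ∀ j, y t j < u j + ε :=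
      eventually_all.2 fun j => eventually_lt_limsup_add (hI j) hε
    obtain ⟨t₀, ht₀⟩ := eventually_atTop.1 (hev.and (eventually_ge_atTop 0))
    have h0 : 0 ≤ t₀ := (ht₀ t₀ le_rfl).2
    refine limsup_le_of_eventually_le (hI i) (eventually_le_of_deriv_le (t₀ := t₀)
      (add_pos_of_nonneg_of_pos hγ (hδ i))
      (fun t ht => (hy t (h0.trans ht) i).mono (Ici_subset_Ici.2 h0)) (fun t ht => ?_) hε)
    have hyc := hc t (h0.trans ht)
    have h1 : f i (y t) ≤ f i (z ε) := hf.monotoneOn i hyc (hz ε hε) fun j =>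
      le_min ((ht₀ t ht).1 j).le (mem_cube.1 hyc j).2
    have h2 := mul_le_mul_of_nonneg_left h1 (sub_nonneg.2 (mem_cube.1 hyc i).2)
    linarith [h t (h0.trans ht) i]
  have hpos : 0 < f i u + δ i := add_pos_of_nonneg_of_pos (hf.nonneg i huc) (hδ i)
  have hlim : Tendsto (fun ε => f i (z ε)) (𝓝[>] 0) (𝓝 (f i u)) := by
    refine (hf.continuousOn i u huc).tendsto.comp (tendsto_nhdsWithin_iff.2 ⟨?_, ?_⟩)
    · refine tendsto_pi_nhds.2 fun j => ?_
      have : Tendsto (fun ε : ℝ => min (u j + ε) 1) (𝓝 0) (𝓝 (min (u j + 0) 1)) :=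
        Continuous.tendsto (by fun_prop) 0
      rw [add_zero, min_eq_left (huI j).2] at this
      exact this.mono_left nhdsWithin_le_nhds
    · filter_upwards [self_mem_nhdsWithin] with ε hε using hz ε hε
  have hlim2 : Tendsto (fun ε => f i (z ε) / (f i (z ε) + δ i) + ε) (𝓝[>] 0)
      (𝓝 (f i u / (f i u + δ i) + 0)) :=
    (hlim.div (hlim.add_const _) hpos.ne').add (tendsto_id.mono_left nhdsWithin_le_nhds)
  have hle := ge_of_tendsto hlim2 (by
    filter_upwards [self_mem_nhdsWithin] with ε hε using key ε hε)
  rw [add_zero, le_div_iff₀ hpos] at hle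
  change δ i * u i ≤ (1 - u i) * f i u
  linarith

/-- The lower limits of a family of asymptotic differential inequalities form a supersolution of
the equilibrium equations. -/
lemma liminf_supersolution (hf : IsSpreadingRate E f) (hδ : ∀ i, 0 < δ i)
    (hc : ∀ t, 0 ≤ t → y t ∈ cube N)
    (hy : ∀ t, 0 ≤ t → ∀ i, HasDerivWithinAt (fun t => y t i) (y' t i) (Ici 0) t)
    (h : ∀ i, ∀ ε > 0, ∀ᶠ t in atTop, (1 - y t i) * f i (y t) - δ i * y t i - ε ≤ y' t i)
    (i : Fin N) :
    (1 - liminf (fun t => y t i) atTop) * (f i fun j => liminf (fun t => y t j) atTop) ≤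
      δ i * liminf (fun t => y t i) atTop := by
  have hI : ∀ j, ∀ᶠ t in atTop, y t j ∈ Icc (0 : ℝ) 1 := fun j => by
    filter_upwards [eventually_ge_atTop 0] with t ht
    exact mem_cube.1 (hc t ht) j
  set l : Fin N → ℝ := fun j => liminf (fun t => y t j) atTop with hl
  have hlI : ∀ j, l j ∈ Icc (0 : ℝ) 1 := fun j => liminf_mem_Icc (hI j)
  have hlc : l ∈ cube N := mem_cube.2 hlI
  let z : ℝ → Fin N → ℝ := fun ε j => max (l j - ε) 0
  have hz : ∀ ε, 0 < ε → z ε ∈ cube N := fun ε hε =>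
    mem_cube.2 fun j => ⟨le_max_right _ _, max_le (by linarith [(hlI j).2]) zero_le_one⟩
  have key : ∀ ε, 0 < ε → (f i (z ε) - ε) / (f i (z ε) + δ i) - ε ≤ l i := by
    intro ε hε
    have hγ := hf.nonneg i (hz ε hε)
    have hev : ∀ᶠ t in atTop, ∀ j, l j - ε < y t j :=
      eventually_all.2 fun j => eventually_liminf_sub_lt (hI j) hε
    obtain ⟨t₀, ht₀⟩ := eventually_atTop.1 ((hev.and (h i ε hε)).and (eventually_ge_atTop 0))
    have h0 : 0 ≤ t₀ := (ht₀ t₀ le_rfl).2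
    refine le_liminf_of_eventually_le (hI i) (eventually_ge_of_le_deriv (t₀ := t₀)
      (add_pos_of_nonneg_of_pos hγ (hδ i))
      (fun t ht => (hy t (h0.trans ht) i).mono (Ici_subset_Ici.2 h0)) (fun t ht => ?_) hε)
    have hyc := hc t (h0.trans ht)
    have h1 : f i (z ε) ≤ f i (y t) := hf.monotoneOn i (hz ε hε) hyc fun j =>
      max_le ((ht₀ t ht).1.1 j).le (mem_cube.1 hyc j).1
    have h2 := mul_le_mul_of_nonneg_left h1 (sub_nonneg.2 (mem_cube.1 hyc i).2)
    linarith [(ht₀ t ht).1.2]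
  have hpos : 0 < f i l + δ i := add_pos_of_nonneg_of_pos (hf.nonneg i hlc) (hδ i)
  have hid : Tendsto (fun ε : ℝ => ε) (𝓝[>] 0) (𝓝 0) := tendsto_id.mono_left nhdsWithin_le_nhds
  have hlim : Tendsto (fun ε => f i (z ε)) (𝓝[>] 0) (𝓝 (f i l)) := by
    refine (hf.continuousOn i l hlc).tendsto.comp (tendsto_nhdsWithin_iff.2 ⟨?_, ?_⟩)
    · refine tendsto_pi_nhds.2 fun j => ?_
      have : Tendsto (fun ε : ℝ => max (l j - ε) 0) (𝓝 0) (𝓝 (max (l j - 0) 0)) :=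
        Continuous.tendsto (by fun_prop) 0
      rw [sub_zero, max_eq_left (hlI j).1] at this
      exact this.mono_left nhdsWithin_le_nhds
    · filter_upwards [self_mem_nhdsWithin] with ε hε using hz ε hε
  have hlim2 : Tendsto (fun ε => (f i (z ε) - ε) / (f i (z ε) + δ i) - ε) (𝓝[>] 0)
      (𝓝 ((f i l - 0) / (f i l + δ i) - 0)) :=
    ((hlim.sub hid).div (hlim.add_const _) hpos.ne').sub hid
  have hle := le_of_tendsto hlim2 (by
    filter_upwards [self_mem_nhdsWithin] with ε hε using key ε hε)
  rw [sub_zero, sub_zero, div_le_iff₀ hpos] at hle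
  change (1 - l i) * f i l ≤ δ i * l i
  linarith

/-- A subsolution of the equilibrium equations lies below any positive supersolution. -/
lemma subsolution_le_supersolution (hf : IsSpreadingRate E f) (hδ : ∀ i, 0 < δ i)
    {u l : Fin N → ℝ} (hu : u ∈ cube N) (hl : l ∈ cube N) (hl0 : ∀ i, 0 < l i)
    (hsub : ∀ i, δ i * u i ≤ (1 - u i) * f i u) (hsup : ∀ i, (1 - l i) * f i l ≤ δ i * l i) :
    u ≤ l := by
  intro k
  have : Nonempty (Fin N) := ⟨k⟩
  -- Let the ratio `u / l` be maximal at `i`, with value `c`. If `c > 1`, sublinearity gives `f i u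
  -- ≤ c * f i l`, so that `δ i * l i ≤ (1 - c * l i) * f i l < (1 - l i) * f i l`, against the
  -- supersolution property.
  obtain ⟨i, hi⟩ := Finite.exists_max fun j => u j / l j
  set c := u i / l i with hc
  have hul : ∀ j, u j ≤ c * l j := fun j => (div_le_iff₀ (hl0 j)).1 (hi j)
  have hui : u i = c * l i := by rw [hc, div_mul_cancel₀ _ (hl0 i).ne']
  by_contra hk
  push Not at hk
  have hc1 : 1 < c := by
    by_contra hc1
    push Not at hc1
    have := mul_le_mul_of_nonneg_right hc1 (hl0 k).le
    linarith [hul k]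
  have hc0 : 0 < c := by linarith
  have hcI : c⁻¹ ∈ Icc (0 : ℝ) 1 := ⟨by positivity, inv_le_one_of_one_le₀ hc1.le⟩
  have h1 : f i u ≤ c * f i l := by
    have h2 := hf.mul_le_apply_smul i hu hcI
    have h3 : f i (c⁻¹ • u) ≤ f i l := hf.monotoneOn i (smul_mem_cube hu hcI) hl fun j => by
      rw [Pi.smul_apply, smul_eq_mul, inv_mul_le_iff₀ hc0]
      exact hul j
    rw [← inv_mul_le_iff₀ hc0]
    exact h2.trans h3
  have h2 := hsub i
  have h3 := hsup i
  have h4 : δ i * l i ≤ (1 - c * l i) * f i l := by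
    have h5 := mul_le_mul_of_nonneg_left h1 (sub_nonneg.2 (mem_cube.1 hu i).2)
    rw [hui] at h2 h5
    refine le_of_mul_le_mul_left ?_ hc0
    linarith
  have hδl := mul_pos (hδ i) (hl0 i)
  have hfl : 0 < f i l := by
    refine (hf.nonneg i hl).lt_of_ne' fun h0 => ?_
    rw [h0] at h4
    linarith
  have := mul_pos (mul_pos (sub_pos.2 hc1) (hl0 i)) hfl
  linarith

/-- A nonzero supersolution of the equilibrium equations is positive. -/
lemma supersolution_pos (hf : IsSpreadingRate E f) (hE : StronglyConnected E)
    {l : Fin N → ℝ} (hl : l ∈ cube N) (hl0 : l ≠ 0)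
    (hsup : ∀ i, (1 - l i) * f i l ≤ δ i * l i) (i : Fin N) : 0 < l i := by
  obtain ⟨k, hk⟩ : ∃ k, l k ≠ 0 := Function.ne_iff.1 hl0
  refine (mem_cube.1 hl i).1.lt_of_ne' fun hi => hk ?_
  have hpath := hE i k
  induction hpath with
  | refl => exact hi
  | tail _ hbc ih =>
    rename_i b c _
    by_contra hc
    -- A zero of `l` spreads along edges: if `l b = 0`, the supersolution inequality gives `f b l ≤
    -- 0`, so `l` vanishes at every `c` with `E b c`.
    have hb : l b = 0 := by
      by_contra hb
      exact hb (ih hb)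
    have h1 := hf.pos hbc hl ((mem_cube.1 hl c).1.lt_of_ne' hc)
    have h2 := hsup b
    rw [hb] at h2
    linarith

/-- There is no nonzero subsolution of the equilibrium equations below the threshold. -/
lemma subsolution_eq_zero (hf : IsSpreadingRate E f) (hδ : ∀ i, 0 < δ i)
    (hs : maxRealPart (jacobianAtZero f - Matrix.diagonal δ) ≤ 0)
    {u : Fin N → ℝ} (hu : u ∈ cube N) (hsub : ∀ i, δ i * u i ≤ (1 - u i) * f i u) : u = 0 := by
  by_contra hu0
  -- The saturation term `u i * f i u` supplies the strict expansion, so the critical case of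
  -- maximal real part `0` is covered too.
  obtain ⟨ε, hε, hεf⟩ : ∃ ε > 0, ∀ i, ε * u i ≤ u i * f i u := by
    have : ∀ᶠ ε : ℝ in 𝓝[>] 0, ∀ i, ε * u i ≤ u i * f i u := eventually_all.2 fun i => by
      rcases (mem_cube.1 hu i).1.eq_or_lt with h0 | h0
      · simp [← h0]
      · have hfi : 0 < f i u := by
          refine (hf.nonneg i hu).lt_of_ne' fun hf0 => ?_
          have := hsub i
          rw [hf0] at this
          linarith [mul_pos (hδ i) h0]
        filter_upwards [Ioc_mem_nhdsGT hfi] with ε hε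
        rw [mul_comm]
        exact mul_le_mul_of_nonneg_left hε.2 h0.le
    obtain ⟨ε, h1, h2⟩ := (eventually_mem_nhdsWithin.and this).exists
    exact ⟨ε, h1, h2⟩
  refine not_lt.2 hs (maxRealPart_pos (fun i j hij => ?_) (fun i => (mem_cube.1 hu i).1) hu0 hε
    fun i => ?_)
  · simpa [hij] using hf.jacobianAtZero_nonneg i j
  · rw [Matrix.sub_mulVec, Pi.sub_apply, Matrix.mulVec_diagonal]
    have h1 := hf.apply_le_jacobian i hu
    have h2 := hεf i
    have h3 := hsub i
    simp only [Matrix.mulVec, dotProduct]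
    linarith

end IsSpreadingRate

lemma one_mem_cube {N : ℕ} : (1 : Fin N → ℝ) ∈ cube N := mem_cube.2 fun _ => by simp

lemma eventually_lt_of_hasDerivWithinAt_pos {y : ℝ → ℝ} {y' t : ℝ}
    (h : HasDerivWithinAt y y' (Ici t) t) (hy' : 0 < y') : ∀ᶠ r in 𝓝[>] t, y t < y r := by
  have h2 := (hasDerivWithinAt_iff_tendsto_slope' self_notMem_Ioi).1 (h.mono Ioi_subset_Ici_self)
  filter_upwards [h2.eventually (eventually_gt_nhds hy'), self_mem_nhdsWithin] with r hr hrt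
  rw [slope_def_field] at hr
  have := (div_pos_iff_of_pos_right (sub_pos.2 hrt)).1 hr
  linarith

/-! ### Strict subsolutions above the threshold -/

namespace IsSpreadingRate

variable {N : ℕ} {E : Fin N → Fin N → Prop} {f : Fin N → (Fin N → ℝ) → ℝ} {δ : Fin N → ℝ}

/-- Above the threshold, all small enough multiples of some vector `v` are strict subsolutions,
with room for a perturbation of size `ρ`. -/
lemma exists_strict_subsolution (hf : IsSpreadingRate E f)
    (hs : 0 < maxRealPart (jacobianAtZero f - Matrix.diagonal δ)) :
    ∃ v ∈ cube N, v ≠ 0 ∧ ∃ ρ > 0, ∀ᶠ m : ℝ in 𝓝[>] 0, m • v ∈ cube N ∧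
      ∀ i, 0 ≤ 1 - ρ - m * v i ∧
        (0 < v i → 0 < (1 - ρ - m * v i) * f i (m • v) - (δ i + ρ) * (m * v i)) := by
  obtain ⟨v₀, hv₀, hv₀0, ε, hε, hQ⟩ := exists_expanded_vector (fun i j hij => by
    simpa [hij] using hf.jacobianAtZero_nonneg i j) hs
  have hn : 0 < ‖v₀‖ := norm_pos_iff.2 hv₀0
  set v := ‖v₀‖⁻¹ • v₀ with hv
  have hvc : v ∈ cube N := mem_cube.2 fun i => by
    refine ⟨mul_nonneg (by positivity) (hv₀ i), ?_⟩
    rw [hv, Pi.smul_apply, smul_eq_mul, inv_mul_le_iff₀ hn, mul_one]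
    exact (le_abs_self _).trans (norm_le_pi_norm v₀ i)
  set a : Fin N → ℝ := fun i => ∑ j, jacobianAtZero f i j * v j with ha
  have hav : ∀ i, ε * v i ≤ a i - δ i * v i := fun i => by
    have h1 := mul_le_mul_of_nonneg_left (hQ i) (inv_nonneg.2 hn.le)
    have h2 : ‖v₀‖⁻¹ * (jacobianAtZero f - Matrix.diagonal δ).mulVec v₀ i = a i - δ i * v i := by
      rw [← smul_eq_mul, ← Pi.smul_apply, ← Matrix.mulVec_smul, ← hv, Matrix.sub_mulVec,
        Pi.sub_apply, Matrix.mulVec_diagonal]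
      rfl
    rw [h2] at h1
    refine le_trans (le_of_eq ?_) h1
    rw [hv, Pi.smul_apply, smul_eq_mul]
    ring
  have hid : Tendsto (fun ρ : ℝ => ρ) (𝓝[>] 0) (𝓝 0) := tendsto_id.mono_left nhdsWithin_le_nhds
  -- At `ρ = 0` the expression is `a i - δ i * v i ≥ ε * v i > 0`, so some `ρ > 0` is affordable.
  obtain ⟨ρ, hρ0, hρ1, hρ⟩ : ∃ ρ : ℝ, 0 < ρ ∧ ρ < 1 ∧
      ∀ i, 0 < v i → 0 < (1 - ρ) * a i - (δ i + ρ) * v i := by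
    have h1 : ∀ᶠ ρ : ℝ in 𝓝[>] 0, ∀ i, 0 < v i → 0 < (1 - ρ) * a i - (δ i + ρ) * v i := by
      refine eventually_all.2 fun i => ?_
      by_cases hi : 0 < v i
      · have hlim : Tendsto (fun ρ : ℝ => (1 - ρ) * a i - (δ i + ρ) * v i) (𝓝[>] 0)
            (𝓝 ((1 - 0) * a i - (δ i + 0) * v i)) :=
          ((hid.const_sub 1).mul_const _).sub ((hid.const_add _).mul_const _)
        have hpos : 0 < (1 - 0) * a i - (δ i + 0) * v i := by
          linarith [hav i, mul_pos hε hi]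
        filter_upwards [hlim.eventually (eventually_gt_nhds hpos)] with ρ h _ using h
      · exact Eventually.of_forall fun ρ h => absurd h hi
    have h0 : ∀ᶠ ρ : ℝ in 𝓝[>] 0, ρ ∈ Ioo 0 1 := Ioo_mem_nhdsGT zero_lt_one
    obtain ⟨ρ, h2, h3⟩ := (h0.and h1).exists
    exact ⟨ρ, h2.1, h2.2, h3⟩
  refine ⟨v, hvc, smul_ne_zero (inv_ne_zero hn.ne') hv₀0, ρ, hρ0, ?_⟩
  have h1 : ∀ᶠ m : ℝ in 𝓝[>] 0, m ∈ Ioc 0 (1 - ρ) := Ioc_mem_nhdsGT (by linarith)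
  have h2 : ∀ᶠ m : ℝ in 𝓝[>] 0, ∀ i, 0 < v i →
      0 < (1 - ρ - m * v i) * (f i (m • v) / m) - (δ i + ρ) * v i := by
    refine eventually_all.2 fun i => ?_
    by_cases hi : 0 < v i
    · have hlim : Tendsto (fun m : ℝ => (1 - ρ - m * v i) * (f i (m • v) / m) - (δ i + ρ) * v i)
          (𝓝[>] 0) (𝓝 ((1 - ρ - 0 * v i) * a i - (δ i + ρ) * v i)) :=
        (((hid.mul_const _).const_sub _).mul (hf.tendsto_smul_div i hvc)).sub_const _
      have hpos : 0 < (1 - ρ - 0 * v i) * a i - (δ i + ρ) * v i := by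
        simpa using hρ i hi
      filter_upwards [hlim.eventually (eventually_gt_nhds hpos)] with m h _ using h
    · exact Eventually.of_forall fun m h => absurd h hi
  filter_upwards [h1, h2] with m hm hm2
  refine ⟨smul_mem_cube hvc ⟨hm.1.le, by linarith [hm.2]⟩, fun i => ⟨?_, fun hi => ?_⟩⟩
  · have := mul_le_mul_of_nonneg_left (mem_cube.1 hvc i).2 hm.1.le
    linarith [hm.2]
  · have h3 := mul_pos hm.1 (hm2 i hi)
    have h4 : m * ((1 - ρ - m * v i) * (f i (m • v) / m) - (δ i + ρ) * v i) =
        (1 - ρ - m * v i) * f i (m • v) - (δ i + ρ) * (m * v i) := by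
      have := hm.1.ne'
      field_simp
    rwa [h4] at h3

end IsSpreadingRate

/-! ### Extinction of the rumor, persistence and convergence of the truth -/

namespace Model.IsSolution

variable {N : ℕ} {M : Model N} {x : ℝ → State N}

/-- Below the threshold the rumor dies out. -/
lemma tendsto_fst (hx : M.IsSolution x) (hs : maxRealPart M.Q₁ ≤ 0) (i : Fin N) :
    Tendsto (fun t => (x t).1 i) atTop (𝓝 0) := by
  have hI : ∀ j, ∀ᶠ t in atTop, (x t).1 j ∈ Icc (0 : ℝ) 1 := fun j => by
    filter_upwards [eventually_ge_atTop 0] with t ht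
    exact mem_cube.1 (hx t ht).1 j
  have hsub := M.fU_rate.limsup_subsolution M.δR_pos (y := fun t => (x t).1)
    (y' := fun t => (M.field (x t)).1) (fun t ht => (hx t ht).1)
    (fun t ht i => hx.hasDerivWithinAt_fst ht i) (fun t ht i => by
      have h1 := mul_le_mul_of_nonneg_left (M.fT_le_fU i _ (hx t ht).1)
        (mem_cube.1 (hx t ht).2.1 i).1
      have h2 := mul_nonneg (mem_cube.1 (hx t ht).1 i).1 (M.gR_rate.nonneg i (hx t ht).2.1)
      simp only [field]
      linarith)
  have hzero := M.fU_rate.subsolution_eq_zero M.δR_pos hs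
    (mem_cube.2 fun j => limsup_mem_Icc (hI j)) hsub
  refine tendsto_of_limsup_le_liminf (hI i) (congrFun hzero i).le (liminf_mem_Icc (hI i)).1

/-- The truth reaches everybody at once. -/
lemma snd_pos (hx : M.IsSolution x) (h0 : x 0 ∈ Ω N) (hT : (x 0).2 ≠ 0) {t : ℝ} (ht : 0 < t)
    (i : Fin N) : 0 < (x t).2 i := by
  obtain ⟨k, hk⟩ : ∃ k, (x 0).2 k ≠ 0 := Function.ne_iff.1 hT
  have hkpos : 0 < (x t).2 k := by
    refine pos_of_le_deriv (a := 0) (c := M.δT k + M.fT k 1)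
      (add_nonneg (M.δT_pos k).le (M.fT_rate.nonneg k one_mem_cube))
      (fun t ht => hx.hasDerivWithinAt_snd ht k) (fun s hs => ?_)
      ((h0.2.1 k).lt_of_ne' hk) t ht.le
    have hΩ := hx.mem_Ω h0 hs
    have h1 := mul_nonneg (sub_nonneg.2 (hΩ.2.2 k)) (M.gU_rate.nonneg k (hx s hs).2.1)
    have h2 := mul_nonneg (hΩ.1 k) (M.gR_rate.nonneg k (hx s hs).2.1)
    have h3 := mul_le_mul_of_nonneg_left (M.fT_rate.monotoneOn k (hx s hs).1 one_mem_cube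
      fun j => (mem_cube.1 (hx s hs).1 j).2) (hΩ.2.1 k)
    simp only [field]
    linarith
  have hΩ := hx.mem_Ω h0 ht.le
  refine (hΩ.2.1 i).lt_of_ne' fun hi => hkpos.ne' ?_
  have hpath := M.stronglyConnected_ET i k
  clear hkpos hk
  induction hpath with
  | refl => exact hi
  | @tail b c _ hbc hb =>
    by_contra hc
    -- As `t > 0` is an interior time, a zero of `T b` is a local minimum and the derivative
    -- vanishes there. But it equals `(1 - R b) * gU + R b * gR`, which is positive if some
    -- informant `c` has positive truth, whether `R b < 1` or `R b = 1`.
    have hmin : IsLocalMin (fun s => (x s).2 b) t := by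
      filter_upwards [lt_mem_nhds ht] with s hs
      rw [hb]
      exact (mem_cube.1 (hx s hs.le).2.1 b).1
    have hder := hmin.hasDerivAt_eq_zero
      ((hx.hasDerivWithinAt_snd ht.le b).hasDerivAt (Ici_mem_nhds ht))
    have hcpos := (hΩ.2.1 c).lt_of_ne' hc
    have h1 := M.gU_rate.pos hbc (hx t ht.le).2.1 hcpos
    have h2 := M.gR_rate.pos hbc (hx t ht.le).2.1 hcpos
    have hb1 : (x t).1 b ≤ 1 := (mem_cube.1 (hx t ht.le).1 b).2
    simp only [field, hb] at hder
    rcases hb1.eq_or_lt with h | h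
    · rw [h] at hder
      linarith
    · have h3 := mul_pos (sub_pos.2 h) h1
      have h4 := mul_nonneg (hΩ.1 b) h2.le
      linarith

lemma tendsto_fT (hx : M.IsSolution x) (hs : maxRealPart M.Q₁ ≤ 0) (i : Fin N) :
    Tendsto (fun t => M.fT i (x t).1) atTop (𝓝 0) := by
  have h := (M.fT_rate.continuousOn i 0 zero_mem_cube).tendsto
  rw [M.fT_rate.nullity i] at h
  refine h.comp (tendsto_nhdsWithin_iff.2 ⟨?_, ?_⟩)
  · exact tendsto_pi_nhds.2 fun j => hx.tendsto_fst hs j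
  · filter_upwards [eventually_ge_atTop 0] with t ht using (hx t ht).1

/-- Above the threshold the truth persists. -/
lemma exists_eventually_le_snd (hx : M.IsSolution x) (h0 : x 0 ∈ Ω N) (hT : (x 0).2 ≠ 0)
    (h₁ : maxRealPart M.Q₁ ≤ 0) (h₂ : 0 < maxRealPart M.Q₂) :
    ∃ w : Fin N → ℝ, 0 ≤ w ∧ w ≠ 0 ∧ ∀ᶠ t in atTop, w ≤ (x t).2 := by
  obtain ⟨v, hv, hv0, ρ, hρ, hm⟩ := M.gU_rate.exists_strict_subsolution h₂
  -- After `t₁` the rumor perturbs the truth equations by no more than the margin `ρ`.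
  obtain ⟨t₁, ht₁⟩ := eventually_atTop.1 ((eventually_all.2 fun i =>
    ((hx.tendsto_fst h₁ i).eventually (eventually_le_nhds hρ)).and
      ((hx.tendsto_fT h₁ i).eventually (eventually_le_nhds hρ))).and (eventually_gt_atTop 0))
  have ht₁0 : 0 < t₁ := (ht₁ t₁ le_rfl).2
  have hinit : ∀ᶠ m : ℝ in 𝓝[>] 0, ∀ i, m * v i ≤ (x t₁).2 i := eventually_all.2 fun i => by
    have hlim : Tendsto (fun m : ℝ => m * v i) (𝓝[>] 0) (𝓝 (0 * v i)) :=
      (tendsto_id.mono_left nhdsWithin_le_nhds).mul_const _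
    rw [zero_mul] at hlim
    exact hlim.eventually (eventually_le_nhds (hx.snd_pos h0 hT ht₁0 i))
  obtain ⟨m, ⟨⟨hmc, hm⟩, hinit⟩, hm0⟩ := ((hm.and hinit).and eventually_mem_nhdsWithin).exists
  have hm0 : 0 < m := hm0
  refine ⟨m • v, hmc.1, smul_ne_zero hm0.ne' hv0, ?_⟩
  filter_upwards [eventually_ge_atTop t₁] with b hb
  have hcont : ∀ t, 0 ≤ t → ∀ i, ContinuousWithinAt (fun t => (x t).2 i) (Ici 0) t :=
    fun t ht i => (hx.hasDerivWithinAt_snd ht i).continuousWithinAt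
  have hclosed : IsClosed ((fun t => (x t).2) ⁻¹' Ici (m • v) ∩ Icc t₁ b) := by
    rw [inter_comm]
    refine ContinuousOn.preimage_isClosed_of_isClosed ?_ isClosed_Icc isClosed_Ici
    exact continuousOn_pi.2 fun i t ht => (hcont t (ht₁0.le.trans ht.1) i).mono
      fun s hs => ht₁0.le.trans hs.1
  -- Continuous induction on `m • v ≤ T`. To the right of `t`, coordinates above the bound stay
  -- there by continuity, those with `v i = 0` are trivial, and a coordinate touching the bound has
  -- positive derivative.
  refine hclosed.Icc_subset_of_forall_mem_nhdsWithin hinit ?_ (right_mem_Icc.2 hb)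
  rintro t ⟨hle, ht⟩
  have htt := ht₁ t ht.1
  have ht0 : 0 < t := htt.2
  have hΩ := hx.mem_Ω h0 ht0.le
  change ∀ᶠ s in 𝓝[>] t, ∀ i, m * v i ≤ (x s).2 i
  refine eventually_all.2 fun i => ?_
  have hlei : m * v i ≤ (x t).2 i := hle i
  rcases hlei.lt_or_eq with hlt | heq
  · filter_upwards [((hcont t ht0.le i).mono fun s hs => ht0.le.trans (le_of_lt hs) :
      ContinuousWithinAt _ (Ioi t) t).eventually (lt_mem_nhds hlt)] with s hs using hs.le
  rcases (mem_cube.1 hv i).1.eq_or_lt with hvi | hvi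
  · filter_upwards [self_mem_nhdsWithin] with s hs
    rw [← hvi, mul_zero]
    exact (mem_cube.1 (hx s (ht0.le.trans (le_of_lt hs))).2.1 i).1
  have hpos : 0 < (M.field (x t)).2 i := by
    obtain ⟨h1, h2⟩ := hm i
    have h2 := h2 hvi
    obtain ⟨hR, hfT⟩ := htt.1 i
    have h3 : M.gU i (m • v) ≤ M.gU i (x t).2 :=
      M.gU_rate.monotoneOn i hmc (hx t ht0.le).2.1 hle
    have h4 := mul_nonneg (hΩ.1 i) (M.gR_rate.nonneg i (hx t ht0.le).2.1)
    have h5 := mul_le_mul (show 1 - ρ - m * v i ≤ 1 - (x t).1 i - (x t).2 i by linarith) h3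
      (M.gU_rate.nonneg i hmc) (by linarith [hΩ.2.2 i])
    have h6 := mul_le_mul_of_nonneg_left hfT (mul_pos hm0 hvi).le
    simp only [field, ← heq] at h5 ⊢
    linarith
  have hd := (hx.hasDerivWithinAt_snd ht0.le i).mono (Ici_subset_Ici.2 ht0.le)
  filter_upwards [eventually_lt_of_hasDerivWithinAt_pos hd hpos] with s hs
  rw [heq]
  exact hs.le

/-- Every admissible solution with a nonzero initial truth part converges to a positive solution
of the equilibrium equations. -/
lemma exists_tendsto (hx : M.IsSolution x) (h0 : x 0 ∈ Ω N) (hT : (x 0).2 ≠ 0)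
    (h₁ : maxRealPart M.Q₁ ≤ 0) (h₂ : 0 < maxRealPart M.Q₂) :
    ∃ T : Fin N → ℝ, T ∈ cube N ∧ (∀ i, 0 < T i) ∧ (∀ i, (1 - T i) * M.gU i T = M.δT i * T i) ∧
      Tendsto x atTop (𝓝 (0, T)) := by
  have hI : ∀ j, ∀ᶠ t in atTop, (x t).2 j ∈ Icc (0 : ℝ) 1 := fun j => by
    filter_upwards [eventually_ge_atTop 0] with t ht
    exact mem_cube.1 (hx t ht).2.1 j
  have hsub := M.gU_rate.limsup_subsolution M.δT_pos (y := fun t => (x t).2)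
    (y' := fun t => (M.field (x t)).2) (fun t ht => (hx t ht).2.1)
    (fun t ht i => hx.hasDerivWithinAt_snd ht i) (fun t ht i => by
      have h1 := mul_le_mul_of_nonneg_left (M.gR_le_gU i _ (hx t ht).2.1)
        (mem_cube.1 (hx t ht).1 i).1
      have h2 := mul_nonneg (mem_cube.1 (hx t ht).2.1 i).1 (M.fT_rate.nonneg i (hx t ht).1)
      simp only [field]
      linarith)
  have hsup := M.gU_rate.liminf_supersolution M.δT_pos (y := fun t => (x t).2)
    (y' := fun t => (M.field (x t)).2) (fun t ht => (hx t ht).2.1)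
    (fun t ht i => hx.hasDerivWithinAt_snd ht i) (fun i ε hε => by
      -- This sum dominates the loss against the pure truth system: `R i * gU` is at most `R i * gU
      -- 1`, and `T i * fT` is at most `fT`.
      have hlim : Tendsto (fun t => (x t).1 i * M.gU i 1 + M.fT i (x t).1) atTop
          (𝓝 (0 * M.gU i 1 + 0)) :=
        ((hx.tendsto_fst h₁ i).mul_const _).add (hx.tendsto_fT h₁ i)
      rw [zero_mul, zero_add] at hlim
      filter_upwards [hlim.eventually (eventually_le_nhds hε), eventually_ge_atTop 0] with t hle ht
      have hR := (mem_cube.1 (hx t ht).1 i).1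
      have h1 := mul_le_mul_of_nonneg_left (M.gU_rate.monotoneOn i (hx t ht).2.1 one_mem_cube
        fun j => (mem_cube.1 (hx t ht).2.1 j).2) hR
      have h2 := mul_nonneg hR (M.gR_rate.nonneg i (hx t ht).2.1)
      have h3 := mul_le_mul_of_nonneg_right (mem_cube.1 (hx t ht).2.1 i).2
        (M.fT_rate.nonneg i (hx t ht).1)
      simp only [field]
      linarith)
  set u : Fin N → ℝ := fun j => limsup (fun t => (x t).2 j) atTop with hu
  set l : Fin N → ℝ := fun j => liminf (fun t => (x t).2 j) atTop with hl
  have huc : u ∈ cube N := mem_cube.2 fun j => limsup_mem_Icc (hI j)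
  have hlc : l ∈ cube N := mem_cube.2 fun j => liminf_mem_Icc (hI j)
  obtain ⟨w, hw, hw0, hev⟩ := hx.exists_eventually_le_snd h0 hT h₁ h₂
  have hwl : w ≤ l := fun j => le_liminf_of_eventually_le (hI j) (hev.mono fun _ h => h j)
  have hl0 : l ≠ 0 := fun h => hw0 (le_antisymm (hwl.trans_eq h) hw)
  have hlpos := M.gU_rate.supersolution_pos M.stronglyConnected_ET hlc hl0 hsup
  have hul : u ≤ l :=
    M.gU_rate.subsolution_le_supersolution M.δT_pos huc hlc hlpos hsub hsup
  have hule : u = l := le_antisymm hul fun j => liminf_le_limsup_of_mem_Icc (hI j)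
  refine ⟨l, hlc, hlpos, fun i => le_antisymm (hsup i) ?_, ?_⟩
  · have := hsub i
    change M.δT i * u i ≤ (1 - u i) * M.gU i u at this
    rwa [hule] at this
  · exact (tendsto_pi_nhds.2 fun i => hx.tendsto_fst h₁ i).prodMk_nhds
      (tendsto_pi_nhds.2 fun i => tendsto_of_limsup_le_liminf (hI i) (hul i) le_rfl)

end Model.IsSolution

lemma continuous_average {N : ℕ} : Continuous (average (N := N)) := by
  unfold average
  fun_prop

end URTU

end

theorem theorem4 {N : ℕ} (M : URTU.Model N)
    (h₁ : URTU.maxRealPart M.Q₁ ≤ 0) (h₂ : 0 < URTU.maxRealPart M.Q₂) :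
    ∃ E : URTU.State N,
      M.IsTruthDominant E ∧ (∀ E', M.IsTruthDominant E' → E' = E) ∧
      M.Attracts E {x | x ∈ URTU.Ω N ∧ x.2 ≠ 0} ∧
      ∀ x : ℝ → URTU.State N, M.IsSolution x → x 0 ∈ URTU.Ω N →
        URTU.average (x 0).2 ≠ 0 →
        Tendsto (fun t => URTU.average (x t).1) atTop (𝓝 0) ∧
        Tendsto (fun t => URTU.average (x t).2) atTop (𝓝 (URTU.average E.2)) := by
  -- A nonzero vector exists, so there is at least one person; this makes `(0, 1)` a start with
  -- nonzero truth.
  obtain ⟨v, -, hv0, -⟩ := M.gU_rate.exists_strict_subsolution h₂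
  obtain ⟨k, -⟩ : ∃ k, v k ≠ 0 := Function.ne_iff.1 hv0
  have hstart : ((0, 1) : URTU.State N) ∈ URTU.Ω N :=
    ⟨fun _ => le_rfl, fun _ => zero_le_one, fun _ => by simp⟩
  obtain ⟨y, hy, hy0⟩ := URTU.Model.exists_isSolution (M := M) hstart
  obtain ⟨T, hTc, hTpos, hTeq, -⟩ := hy.exists_tendsto (by rwa [hy0])
    (by rw [hy0]; exact fun h => one_ne_zero (congrFun h k)) h₁ h₂
  have hconv : ∀ x, M.IsSolution x → x 0 ∈ URTU.Ω N → (x 0).2 ≠ 0 →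
      Tendsto x atTop (𝓝 (0, T)) := by
    intro x hx h0 hne
    obtain ⟨T', hTc', hTpos', hTeq', hlim⟩ := hx.exists_tendsto h0 hne h₁ h₂
    have h : T' = T := le_antisymm
      (M.gU_rate.subsolution_le_supersolution M.δT_pos hTc' hTc hTpos (fun i => (hTeq' i).ge)
        fun i => (hTeq i).le)
      (M.gU_rate.subsolution_le_supersolution M.δT_pos hTc hTc' hTpos' (fun i => (hTeq i).ge)
        fun i => (hTeq' i).le)
    rwa [h] at hlim
  refine ⟨(0, T), ⟨⟨⟨fun _ => le_rfl, fun i => (hTpos i).le, fun i => ?_⟩, ?_⟩, rfl, ?_⟩, ?_, ?_, ?_⟩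
  · simpa using (URTU.mem_cube.1 hTc i).2
  · refine Prod.ext (funext fun i => ?_) (funext fun i => ?_)
    · simp [URTU.Model.field, M.fU_rate.nullity, M.fT_rate.nullity]
    · simp [URTU.Model.field, M.fT_rate.nullity, hTeq]
  · exact fun h => (hTpos k).ne' (congrFun h k)
  · rintro E ⟨⟨hE, hE0⟩, -, hE2⟩
    have hsol : M.IsSolution fun _ => E := fun t _ =>
      ⟨URTU.fst_mem_cube_of_mem_Ω hE, URTU.snd_mem_cube_of_mem_Ω hE, by
        rw [hE0]; exact hasDerivWithinAt_const _ _ _⟩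
    exact tendsto_nhds_unique tendsto_const_nhds (hconv _ hsol hE hE2)
  · rintro x₀ ⟨hx₀, hne⟩
    refine ⟨URTU.Model.exists_isSolution hx₀, ?_⟩
    rintro x hx rfl
    exact hconv x hx hx₀ hne
  · intro x hx h0 hne
    have hlim := hconv x hx h0 fun h => hne (by simp [h, URTU.average])
    constructor
    · have := (URTU.continuous_average.tendsto _).comp ((continuous_fst.tendsto _).comp hlim)
      have h0 : URTU.average (0 : Fin N → ℝ) = 0 := by simp [URTU.average]
      rw [h0] at this
      exact this
    · exact (URTU.continuous_average.tendsto _).comp ((continuous_snd.tendsto _).comp hlim)
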